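/- Let $N\ge 1$ be an integer and let $\Pi$ be a set of two-coloured partitions containing the four mixed-coloured pair partitions (two points, one white and one black in either order, both upper or both lower, forming one block). A two-coloured partition $p$ has $k$ upper points with colours $\omega\in\{1,*\}^k$ and $l$ lower points with colours $\omega'\in\{1,*\}^l$ (white $=1$, black $=*$). A labeling of the points of a row by $[N]=\{1,\dots,N\}$ is valid if points of that row in the same block have equal labels. Let $T_0\subseteq[N]^k$ and $T_0'\subseteq[N]^l$ be the non-valid labelings of the upper and of the lower row. Let $T_1,\dots,T_r$ and $T_1',\dots,T_r'$, $r=N^{tb(p)}$, be the sets of valid labelings of the upper, respectively lower, row that restrict to the $i$-th labeling of the $tb(p)$ through-blocks (the blocks containing both upper and lower points). For a matrix $y=(y_{ij})$ over a $*$-algebra write $y^{\omega}_{s,t}=y_{s_1t_1}^{\omega_1}\cdots y_{s_kt_k}^{\omega_k}$ (equal to $1$ if $k=0$). The relations $R^{Gr}_p(u)$ for an $N\times N$ matrix $u$ are: (i) $\sum_{t\in T_i}u^{\omega}_{t,\gamma}=\sum_{t'\in T'_j}u^{\omega'}_{\gamma',t'}$ for $1\le i,j\le r$, $\gamma\in T_j$,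 $\gamma'\in T_i'$; (ii) $\sum_{t\in T_i}u^{\omega}_{t,\gamma}=0$ for $1\le i\le r$, $\gamma\in T_0$; (iii) $\sum_{t'\in T'_j}u^{\omega'}_{\gamma',t'}=0$ for $1\le j\le r$, $\gamma'\in T_0'$. The relations $R^{Sp}_p(x)$ for an $N\times N$ matrix $x$ are: (i) $\sum_{t\in T_i}x^{\omega}_{t,\gamma}=\sum_{t'\in T'_i}x^{\omega'}_{t',\gamma'}$ for $1\le i,j\le r$, $\gamma\in T_j$, $\gamma'\in T'_j$; (ii) $\sum_{t\in T_i}x^{\omega}_{t,\gamma}=0$ for $1\le i\le r$, $\gamma\in T_0$; (iii) $\sum_{t'\in T'_i}x^{\omega'}_{t',\gamma'}=0$ for $1\le i\le r$, $\gamma'\in T'_0$. Let $C(G_N(\Pi))$ be the universal unital $C^*$-algebra generated by the entries of $u=(u_{ij})_{1\le i,j\le N}$ subject to $R^{Gr}_p(u)$ for all $p\in\Pi$, and let $C(X_{N,N}(\Pi))$ be the universal unital $C^*$-algebra generated by the entries of $x=(x_{ij})_{1\le i,j\le N}$ subject to $R^{Sp}_p(x)$ for all $p\in\Pi$. A compact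 matrix quantum group $G$ is a unital $C^*$-algebra $C(G)$ generated by the entries of a matrix $v=(v_{ij})_{1\le i,j\le N}$ such that $v$ and $\bar v=(v_{ij}^*)$ are invertible and there is a unital $*$-homomorphism $\Delta:C(G)\to C(G)\otimes C(G)$ with $\Delta(v_{ij})=\sum_k v_{ik}\otimes v_{kj}$, where $\otimes$ is the minimal tensor product. A left (right) matrix-vector action of $G$ on $X_{N,N}(\Pi)$ is a unital $*$-homomorphism $C(X_{N,N}(\Pi))\to C(G)\otimes C(X_{N,N}(\Pi))$ with $x_{ij}\mapsto\sum_k v_{ik}\otimes x_{kj}$ (respectively $x_{ij}\mapsto\sum_k v_{ki}\otimes x_{kj}$) for all $i,j$. A quantum symmetry group of $X_{N,N}(\Pi)$ is a compact matrix quantum group $G$ with left and right matrix-vector actions on $X_{N,N}(\Pi)$ that is maximal: for every compact matrix quantum group $G'$ with fundamental $N\times N$ matrix $v'$ having such left and right actions, there is a $*$-homomorphism $C(G)\to C(G')$ with $v_{ij}\mapsto v'_{ij}$ for all $i,j$. Then $G_N(\Pi)$, with fundamental matrix $u$, is a quantum symmetry group of $X_{N,N}(\Pi)$. Moreover, it is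 the only one: for every quantum symmetry group $G$ of $X_{N,N}(\Pi)$ with fundamental matrix $v$ there is a $*$-isomorphism $C(G_N(\Pi))\to C(G)$ with $u_{ij}\mapsto v_{ij}$ for all $i,j$. -/

import Mathlib

open scoped TensorProduct

universe u v w

noncomputable section

/-- A C*-seminorm on a unital complex *-algebra `F`: a submultiplicative seminorm satisfying
`p (a* a) = p a ^ 2`. These are exactly the functions `a ↦ ‖π a‖` for unital *-homomorphisms `π`
from `F` to a unital C*-algebra. -/
structure CStarSeminorm (F : Type*) [Ring F] [StarRing F] [Algebra ℂ F] where
  toSeminorm : Seminorm ℂ F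
  mul_le : ∀ a b, toSeminorm (a * b) ≤ toSeminorm a * toSeminorm b
  star_mul_self : ∀ a, toSeminorm (star a * a) = toSeminorm a ^ 2

namespace CStarSeminorm

section Basic

variable {F : Type*} [Ring F] [StarRing F] [Algebra ℂ F]

instance : CoeFun (CStarSeminorm F) (fun _ => F → ℝ) := ⟨fun p => p.toSeminorm⟩

lemma nonneg (p : CStarSeminorm F) (a : F) : 0 ≤ p a := apply_nonneg p.toSeminorm a

lemma le_star (p : CStarSeminorm F) (a : F) : p a ≤ p (star a) := by
  by_contra! h
  have h1 := p.mul_le (star a) a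
  rw [p.star_mul_self] at h1
  have h0 : 0 ≤ p (star a) := p.nonneg _
  nlinarith

lemma star_eq (p : CStarSeminorm F) (a : F) : p (star a) = p a :=
  le_antisymm (by simpa using p.le_star (star a)) (p.le_star a)

instance : Zero (CStarSeminorm F) := ⟨⟨0, fun _ _ => by simp, fun _ => by simp⟩⟩

open Classical in
/-- The pointwise supremum of a pointwise bounded set of C*-seminorms (and `0` if the set is not
pointwise bounded). -/
def sup (S : Set (CStarSeminorm F)) : CStarSeminorm F :=
  if h : ∀ a, BddAbove (Set.range fun p : S => p.1 a) then
    have nn : ∀ a, 0 ≤ ⨆ p : S, p.1 a := fun a => Real.iSup_nonneg fun p => p.1.nonneg a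
    { toSeminorm := Seminorm.of (fun a => ⨆ p : S, p.1 a)
        (fun a b => Real.iSup_le (fun p => (map_add_le_add p.1.toSeminorm a b).trans
          (add_le_add (le_ciSup (h a) p) (le_ciSup (h b) p))) (add_nonneg (nn a) (nn b)))
        (fun c a => by
          simp only [map_smul_eq_mul]
          exact (Real.mul_iSup_of_nonneg (norm_nonneg c) _).symm)
      mul_le := fun a b => Real.iSup_le (fun p => (p.1.mul_le a b).trans
          (mul_le_mul (le_ciSup (h a) p) (le_ciSup (h b) p) (p.1.nonneg _) (nn a)))
          (mul_nonneg (nn a) (nn b))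
      star_mul_self := fun a => by
        apply le_antisymm
        · refine Real.iSup_le (fun p => ?_) (sq_nonneg _)
          rw [p.1.star_mul_self]
          exact pow_le_pow_left₀ (p.1.nonneg _) (le_ciSup (h a) p) 2
        · refine (Real.le_sqrt (nn a) (nn _)).1 (Real.iSup_le (fun p => ?_) (Real.sqrt_nonneg _))
          refine (Real.le_sqrt (p.1.nonneg a) (nn _)).2 ?_
          rw [← p.1.star_mul_self]
          exact le_ciSup (h (star a * a)) p }
  else 0

/-- The *-algebra `F`, regarded as a seminormed algebra via `p`. -/
def Pre (_p : CStarSeminorm F) : Type _ := F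

variable (p : CStarSeminorm F)

instance instRingPre : Ring p.Pre := inferInstanceAs (Ring F)
instance instStarRingPre : StarRing p.Pre := inferInstanceAs (StarRing F)
instance instAlgebraPre : Algebra ℂ p.Pre := inferInstanceAs (Algebra ℂ F)
instance : SeminormedRing p.Pre :=
  { instRingPre p with
    __ := AddGroupSeminorm.toSeminormedAddCommGroup (E := p.Pre) p.toSeminorm.toAddGroupSeminorm
    norm_mul_le := p.mul_le }
instance : NormedAlgebra ℂ p.Pre where
  __ := instAlgebraPre p
  norm_smul_le c a := (map_smul_eq_mul p.toSeminorm c a).le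
instance : NormedStarGroup p.Pre where
  norm_star_le a := (p.star_eq a).le

/-- The Hausdorff completion of `F` with respect to `p`. -/
abbrev Completion : Type _ := UniformSpace.Completion p.Pre

/-- The canonical map from `F` to its completion. -/
def toCompl (a : F) : p.Completion := ((show p.Pre from a : p.Pre) : UniformSpace.Completion p.Pre)

lemma norm_toCompl (a : F) : ‖p.toCompl a‖ = p a :=
  UniformSpace.Completion.norm_coe (E := p.Pre) a

lemma denseRange_toCompl : DenseRange p.toCompl :=
  UniformSpace.Completion.denseRange_coe (α := p.Pre)

lemma toCompl_add (a b : F) : p.toCompl (a + b) = p.toCompl a + p.toCompl b :=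
  UniformSpace.Completion.coe_add (α := p.Pre) a b

lemma toCompl_mul (a b : F) : p.toCompl (a * b) = p.toCompl a * p.toCompl b :=
  UniformSpace.Completion.coe_mul (α := p.Pre) a b

lemma toCompl_smul (c : ℂ) (a : F) : p.toCompl (c • a) = c • p.toCompl a :=
  UniformSpace.Completion.coe_smul (X := p.Pre) c a

instance : NormedAlgebra ℂ p.Completion where
  norm_smul_le := norm_smul_le

instance : Star p.Completion :=
  ⟨UniformSpace.Completion.map (α := p.Pre) (β := p.Pre) star⟩

lemma continuous_star' : Continuous (star : p.Completion → p.Completion) :=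
  UniformSpace.Completion.continuous_map

lemma toCompl_star (a : F) : p.toCompl (star a) = star (p.toCompl a) :=
  (UniformSpace.Completion.map_coe (α := p.Pre) (β := p.Pre)
    (f := star) (starNormedAddGroupHom (E := p.Pre)).uniformContinuous a).symm

instance : StarRing p.Completion where
  star_involutive x := by
    have := p.continuous_star'
    refine p.denseRange_toCompl.induction_on (p := fun x => star (star x) = x) x
      (isClosed_eq (by fun_prop) (by fun_prop)) (fun a => ?_)
    rw [← toCompl_star, ← toCompl_star, star_star]
  star_mul x y := by
    have := p.continuous_star'
    refine p.denseRange_toCompl.induction_on₂ (p := fun x y => star (x * y) = star y * star x)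
      (isClosed_eq (by fun_prop) (by fun_prop)) (fun a b => ?_) x y
    rw [← toCompl_mul, ← toCompl_star, star_mul, toCompl_mul, toCompl_star, toCompl_star]
  star_add x y := by
    have := p.continuous_star'
    refine p.denseRange_toCompl.induction_on₂ (p := fun x y => star (x + y) = star x + star y)
      (isClosed_eq (by fun_prop) (by fun_prop)) (fun a b => ?_) x y
    rw [← toCompl_add, ← toCompl_star, star_add, toCompl_add, toCompl_star, toCompl_star]

variable [StarModule ℂ F]

/-- The completion of a *-algebra with respect to a C*-seminorm is a unital C*-algebra. -/
instance : CStarAlgebra p.Completion where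
  norm_mul_self_le x := by
    have := p.continuous_star'
    refine p.denseRange_toCompl.induction_on (p := fun x => ‖x‖ * ‖x‖ ≤ ‖star x * x‖) x
      (isClosed_le (by fun_prop) (by fun_prop)) (fun a => ?_)
    rw [← toCompl_star, ← toCompl_mul, norm_toCompl, norm_toCompl, p.star_mul_self, sq]
  star_smul c x := by
    have := p.continuous_star'
    refine p.denseRange_toCompl.induction_on (p := fun x => star (c • x) = star c • star x) x
      (isClosed_eq (this.comp (continuous_const_smul c))
        ((continuous_const_smul (star c)).comp this)) (fun a => ?_)
    rw [← toCompl_smul, ← toCompl_star, star_smul, toCompl_smul, toCompl_star]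

/-- The canonical unital *-homomorphism from `F` to its completion. -/
def toComplHom : F →⋆ₐ[ℂ] p.Completion where
  toFun := p.toCompl
  map_one' := UniformSpace.Completion.coe_one (α := p.Pre)
  map_mul' := p.toCompl_mul
  map_zero' := UniformSpace.Completion.coe_zero (α := p.Pre)
  map_add' := p.toCompl_add
  commutes' c := by
    rw [Algebra.algebraMap_eq_smul_one, Algebra.algebraMap_eq_smul_one, toCompl_smul]
    exact congrArg _ (UniformSpace.Completion.coe_one (α := p.Pre))
  map_star' := p.toCompl_star

end Basic

end CStarSeminorm

section MinimalTensorProduct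

variable {A B H K : Type*} [CStarAlgebra A] [CStarAlgebra B]
  [NormedAddCommGroup H] [InnerProductSpace ℂ H] [CompleteSpace H]
  [NormedAddCommGroup K] [InnerProductSpace ℂ K] [CompleteSpace K]

/-- The representation `π ⊗ ρ` of the algebraic tensor product on the pre-Hilbert space
tensor product `H ⊗ K`, with `(π ⊗ ρ) (a ⊗ b) = π a ⊗ ρ b`. -/
def tensorRep (π : A →⋆ₐ[ℂ] (H →L[ℂ] H)) (ρ : B →⋆ₐ[ℂ] (K →L[ℂ] K)) :
    A ⊗[ℂ] B →ₐ[ℂ] ((H ⊗[ℂ] K) →L[ℂ] (H ⊗[ℂ] K)) :=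
  Algebra.TensorProduct.algHomOfLinearMapTensorProduct
    (TensorProduct.lift (LinearMap.mk₂ ℂ (fun a b => TensorProduct.mapL (π a) (ρ b))
      (fun a a' b => by rw [map_add, TensorProduct.mapL_add_left])
      (fun c a b => by rw [map_smul, TensorProduct.mapL_smul_left])
      (fun a b b' => by rw [map_add, TensorProduct.mapL_add_right])
      (fun c a b => by rw [map_smul, TensorProduct.mapL_smul_right])))
    (fun a a' b b' => by simp [TensorProduct.mapL_mul])
    (by simp [ContinuousLinearMap.one_def])

lemma tensorRep_tmul (π : A →⋆ₐ[ℂ] (H →L[ℂ] H)) (ρ : B →⋆ₐ[ℂ] (K →L[ℂ] K)) (a : A) (b : B) :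
    tensorRep π ρ (a ⊗ₜ b) = TensorProduct.mapL (π a) (ρ b) := rfl

lemma inner_tensorRep (π : A →⋆ₐ[ℂ] (H →L[ℂ] H)) (ρ : B →⋆ₐ[ℂ] (K →L[ℂ] K)) (x : A ⊗[ℂ] B)
    (ξ η : H ⊗[ℂ] K) :
    inner ℂ (tensorRep π ρ x ξ) η = inner ℂ ξ (tensorRep π ρ (star x) η) := by
  induction x with
  | zero => simp
  | add x y hx hy => simp [inner_add_left, inner_add_right, hx, hy]
  | tmul a b =>
    induction ξ with
    | zero => simp
    | add ξ ξ' h h' => simp only [map_add, inner_add_left, h, h']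
    | tmul h k =>
      induction η with
      | zero => simp
      | add ξ ξ' h h' => simp only [map_add, inner_add_right, h, h']
      | tmul h' k' =>
        rw [TensorProduct.star_tmul, tensorRep_tmul, tensorRep_tmul, TensorProduct.mapL_tmul,
          TensorProduct.mapL_tmul, TensorProduct.inner_tmul, TensorProduct.inner_tmul,
          map_star, map_star, ContinuousLinearMap.star_eq_adjoint,
          ContinuousLinearMap.star_eq_adjoint, ContinuousLinearMap.adjoint_inner_right,
          ContinuousLinearMap.adjoint_inner_right]

/-- The C*-seminorm `x ↦ ‖(π ⊗ ρ) x‖` on the algebraic tensor product. -/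
def tensorRepSeminorm (π : A →⋆ₐ[ℂ] (H →L[ℂ] H)) (ρ : B →⋆ₐ[ℂ] (K →L[ℂ] K)) :
    CStarSeminorm (A ⊗[ℂ] B) where
  toSeminorm := (normSeminorm ℂ ((H ⊗[ℂ] K) →L[ℂ] (H ⊗[ℂ] K))).comp (tensorRep π ρ).toLinearMap
  mul_le x y := by
    simpa using norm_mul_le (tensorRep π ρ x) (tensorRep π ρ y)
  star_mul_self x := by
    have key : ∀ y, ‖tensorRep π ρ y‖ ^ 2 ≤ ‖tensorRep π ρ (star y * y)‖ := fun y => by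
      refine (Real.le_sqrt (norm_nonneg (tensorRep π ρ y))
        (norm_nonneg (tensorRep π ρ (star y * y)))).1
        ((tensorRep π ρ y).opNorm_le_bound (Real.sqrt_nonneg _) fun ξ => ?_)
      refine (sq_le_sq₀ (norm_nonneg _) (by positivity)).1 ?_
      rw [mul_pow, Real.sq_sqrt (norm_nonneg _), ← inner_self_eq_norm_sq (𝕜 := ℂ),
        inner_tensorRep]
      rw [← mul_apply_eq_comp, ← map_mul]
      refine (RCLike.re_le_norm _).trans ((norm_inner_le_norm (𝕜 := ℂ) ξ (tensorRep π ρ (star y * y) ξ)).trans ?_)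
      nlinarith [(tensorRep π ρ (star y * y)).le_opNorm ξ, norm_nonneg ξ]
    have hm : ∀ y, ‖tensorRep π ρ (star y * y)‖ ≤ ‖tensorRep π ρ (star y)‖ * ‖tensorRep π ρ y‖ :=
      fun y => by rw [map_mul]; exact norm_mul_le (tensorRep π ρ (star y)) (tensorRep π ρ y)
    have hs : ∀ y, ‖tensorRep π ρ y‖ ≤ ‖tensorRep π ρ (star y)‖ := fun y => by
      by_contra! h
      nlinarith [key y, hm y, norm_nonneg (tensorRep π ρ (star y))]
    have he : ‖tensorRep π ρ (star x)‖ = ‖tensorRep π ρ x‖ :=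
      le_antisymm (by simpa using hs (star x)) (hs x)
    have h2 := hm x
    rw [he, ← sq] at h2
    exact le_antisymm h2 (key x)

end MinimalTensorProduct

/-- The minimal (spatial) C*-norm on the algebraic tensor product: the supremum of
`‖(π ⊗ ρ) x‖` over all representations `π` of `A` and `ρ` of `B` on Hilbert spaces. Hilbert spaces
in the universes of `A` and `B` suffice, since `A` and `B` have faithful representations there. -/
def minTensorSeminorm (A : Type u) (B : Type v) [CStarAlgebra A] [CStarAlgebra B] :
    CStarSeminorm (A ⊗[ℂ] B) :=
  CStarSeminorm.sup {q | ∃ (H : Type u) (_ : NormedAddCommGroup H) (_ : InnerProductSpace ℂ H)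
    (_ : CompleteSpace H) (K : Type v) (_ : NormedAddCommGroup K) (_ : InnerProductSpace ℂ K)
    (_ : CompleteSpace K) (π : A →⋆ₐ[ℂ] (H →L[ℂ] H)) (ρ : B →⋆ₐ[ℂ] (K →L[ℂ] K)),
    q = tensorRepSeminorm π ρ}

/-- The set of seminorms in the definition of the minimal C*-norm is pointwise bounded. -/
lemma minTensorSeminorm_bddAbove (A : Type u) (B : Type v) [CStarAlgebra A] [CStarAlgebra B]
    (x : A ⊗[ℂ] B) : ∃ C : ℝ, ∀ (H : Type u) [NormedAddCommGroup H] [InnerProductSpace ℂ H]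
    [CompleteSpace H] (K : Type v) [NormedAddCommGroup K] [InnerProductSpace ℂ K]
    [CompleteSpace K] (π : A →⋆ₐ[ℂ] (H →L[ℂ] H)) (ρ : B →⋆ₐ[ℂ] (K →L[ℂ] K)),
    tensorRepSeminorm π ρ x ≤ C := by
  induction x with
  | zero => exact ⟨0, fun H _ _ _ K _ _ _ π ρ => (map_zero (tensorRepSeminorm π ρ).toSeminorm).le⟩
  | add x y hx hy =>
    obtain ⟨C, hC⟩ := hx
    obtain ⟨D, hD⟩ := hy
    exact ⟨C + D, fun H _ _ _ K _ _ _ π ρ =>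
      (map_add_le_add (tensorRepSeminorm π ρ).toSeminorm x y).trans
        (add_le_add (hC H K π ρ) (hD H K π ρ))⟩
  | tmul a b =>
    refine ⟨‖a‖ * ‖b‖, fun H _ _ _ K _ _ _ π ρ => (TensorProduct.norm_mapL_le (π a) (ρ b)).trans ?_⟩
    exact mul_le_mul (NonUnitalStarAlgHom.norm_apply_le π a)
      (NonUnitalStarAlgHom.norm_apply_le ρ b) (norm_nonneg _) (norm_nonneg _)

/-- The minimal tensor product of two unital C*-algebras. -/
abbrev MinTensor (A : Type u) (B : Type v) [CStarAlgebra A] [CStarAlgebra B] : Type (max u v) :=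
  (minTensorSeminorm A B).Completion

/-- The elementary tensor `a ⊗ b` in the minimal tensor product. -/
def minTmul {A : Type u} {B : Type v} [CStarAlgebra A] [CStarAlgebra B] (a : A) (b : B) :
    MinTensor A B :=
  (minTensorSeminorm A B).toComplHom (a ⊗ₜ[ℂ] b)

/-- The free unital complex *-algebra on a set `X` of generators: the algebra of words in the
letters `(g, false)`, representing the generator `g`, and `(g, true)`, representing `g*`. -/
def FreeStarAlg (X : Type u) : Type u := MonoidAlgebra ℂ (FreeMonoid (X × Bool))

namespace FreeStarAlg

variable {X : Type u}

instance : Ring (FreeStarAlg X) := inferInstanceAs (Ring (MonoidAlgebra ℂ (FreeMonoid (X × Bool))))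
instance : Algebra ℂ (FreeStarAlg X) :=
  inferInstanceAs (Algebra ℂ (MonoidAlgebra ℂ (FreeMonoid (X × Bool))))

/-- The adjoint of a word: reverse it and take the adjoint of each letter. -/
def wordStar (w : FreeMonoid (X × Bool)) : FreeMonoid (X × Bool) :=
  star (FreeMonoid.map (fun a => (a.1, !a.2)) w)

lemma wordStar_wordStar (w : FreeMonoid (X × Bool)) : wordStar (wordStar w) = w := by
  induction w using FreeMonoid.inductionOn' with
  | one => rfl
  | of_mul a w ih => simp_all [wordStar]

lemma wordStar_mul (w w' : FreeMonoid (X × Bool)) :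
    wordStar (w * w') = wordStar w' * wordStar w := by
  simp [wordStar]

/-- The monomial `c • w`. -/
def mon (w : FreeMonoid (X × Bool)) (c : ℂ) : FreeStarAlg X := MonoidAlgebra.single w c

lemma mon_mul (w w' : FreeMonoid (X × Bool)) (c c' : ℂ) :
    mon w c * mon w' c' = mon (w * w') (c * c') :=
  MonoidAlgebra.single_mul_single w w' c c'

lemma smul_mon (w : FreeMonoid (X × Bool)) (c c' : ℂ) : c • mon w c' = mon w (c * c') :=
  MonoidAlgebra.smul_single c w c'

lemma induction_mon {P : FreeStarAlg X → Prop} (f : FreeStarAlg X) (zero : P 0)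
    (add : ∀ f g, P f → P g → P (f + g)) (mon : ∀ w c, P (mon w c)) : P f :=
  MonoidAlgebra.induction_linear (R := ℂ) (M := FreeMonoid (X × Bool)) f zero add mon

/-- The involution, sending `c • w` to `conj c • w*`. -/
instance : Star (FreeStarAlg X) :=
  ⟨fun f => MonoidAlgebra.mapDomain (R := ℂ) wordStar
    (MonoidAlgebra.mapRingHom (FreeMonoid (X × Bool)) (starRingEnd ℂ) f)⟩

lemma star_zero' : star (0 : FreeStarAlg X) = 0 :=
  (congrArg (MonoidAlgebra.mapDomain (R := ℂ) wordStar)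
    (map_zero (MonoidAlgebra.mapRingHom (FreeMonoid (X × Bool)) (starRingEnd ℂ)))).trans
    (MonoidAlgebra.mapDomain_zero _)

lemma star_add' (f g : FreeStarAlg X) : star (f + g) = star f + star g :=
  (congrArg (MonoidAlgebra.mapDomain (R := ℂ) wordStar)
    (map_add (MonoidAlgebra.mapRingHom (FreeMonoid (X × Bool)) (starRingEnd ℂ)) f g)).trans
    (MonoidAlgebra.mapDomain_add _ _ _)

lemma star_mon (w : FreeMonoid (X × Bool)) (c : ℂ) :
    star (mon w c) = mon (wordStar w) (star c) :=
  (congrArg (MonoidAlgebra.mapDomain (R := ℂ) wordStar)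
    (MonoidAlgebra.mapRingHom_single (starRingEnd ℂ) w c)).trans
    MonoidAlgebra.mapDomain_single

instance : StarRing (FreeStarAlg X) where
  star_involutive f := by
    induction f using induction_mon with
    | zero => rw [star_zero', star_zero']
    | add f g hf hg => rw [star_add', star_add', hf, hg]
    | mon w c => rw [star_mon, star_mon, wordStar_wordStar, star_star]
  star_mul f g := by
    induction f using induction_mon with
    | zero => rw [zero_mul, star_zero', mul_zero]
    | add f f' hf hf' => rw [add_mul, star_add', star_add', hf, hf', mul_add]
    | mon w c =>
      induction g using induction_mon with
      | zero => rw [mul_zero, star_zero', zero_mul]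
      | add f f' hf hf' => rw [mul_add, star_add', star_add', hf, hf', add_mul]
      | mon w' c' => rw [mon_mul, star_mon, star_mon, star_mon, mon_mul, wordStar_mul, star_mul]
  star_add := star_add'

instance : StarModule ℂ (FreeStarAlg X) where
  star_smul c f := by
    induction f using induction_mon with
    | zero => simp
    | add f g hf hg => rw [smul_add, star_add, hf, hg, star_add, smul_add]
    | mon w c' => rw [smul_mon, star_mon, star_mon, smul_mon, star_mul']

/-- The generator `g` of the free *-algebra. -/
def gen (g : X) : FreeStarAlg X := mon (FreeMonoid.of (g, false)) 1

end FreeStarAlg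

/-- The universal C*-seminorm for generators `X` and relations `R` (a pair `(a, b)` standing for
the relation `a = b`): the supremum of all C*-seminorms on the free *-algebra for which the
relations hold. -/
def univSeminorm {X : Type u} (R : Set (FreeStarAlg X × FreeStarAlg X)) :
    CStarSeminorm (FreeStarAlg X) :=
  CStarSeminorm.sup {p | ∀ r ∈ R, p (r.1 - r.2) = 0}

/-- The universal unital C*-algebra `C*(X | R)`. It exists if the C*-seminorms for which the
relations hold are pointwise bounded. -/
abbrev UnivCStar {X : Type u} (R : Set (FreeStarAlg X × FreeStarAlg X)) : Type u :=
  (univSeminorm R).Completion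

/-- The generator `g` of the universal C*-algebra. -/
def UnivCStar.gen {X : Type u} (R : Set (FreeStarAlg X × FreeStarAlg X)) (g : X) : UnivCStar R :=
  (univSeminorm R).toComplHom (FreeStarAlg.gen g)

/-! ### Two-coloured partitions -/

/-- The colours of points; white corresponds to the exponent `1` and black to `*`. -/
inductive Color where
  | white
  | black

/-- `a ^ ω` for `ω ∈ {1, *}`. -/
def Color.act {A : Type*} [Star A] : Color → A → A
  | white, a => a
  | black, a => star a

/-- A two-coloured partition with `k` upper and `l` lower points. The blocks are the equivalence
classes of `rel`. -/
structure ColPartition where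
  k : ℕ
  l : ℕ
  upper : Fin k → Color
  lower : Fin l → Color
  rel : Setoid (Fin k ⊕ Fin l)

namespace ColPartition

/-- The partition with two lower points of colours `a`, `b` in one block. -/
def lowerPair (a b : Color) : ColPartition := ⟨0, 2, ![], ![a, b], ⊤⟩

/-- The partition with two upper points of colours `a`, `b` in one block. -/
def upperPair (a b : Color) : ColPartition := ⟨2, 0, ![a, b], ![], ⊤⟩

/-- The four mixed-coloured pair partitions. -/
def mixedPairs : Set ColPartition :=
  {lowerPair .white .black, lowerPair .black .white,
    upperPair .white .black, upperPair .black .white}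

variable (p : ColPartition)

/-- The through-blocks: the blocks that contain both upper and lower points. -/
def ThroughBlock : Type :=
  {b : Quotient p.rel // (∃ s, Quotient.mk p.rel (Sum.inl s) = b) ∧
    ∃ s, Quotient.mk p.rel (Sum.inr s) = b}

/-- Valid labelings of the upper row: connected points have equal labels. -/
def ValidUpper {N : ℕ} (t : Fin p.k → Fin N) : Prop :=
  ∀ s s', p.rel (Sum.inl s) (Sum.inl s') → t s = t s'

/-- Valid labelings of the lower row: connected points have equal labels. -/
def ValidLower {N : ℕ} (t : Fin p.l → Fin N) : Prop :=
  ∀ s s', p.rel (Sum.inr s) (Sum.inr s') → t s = t s'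

open Classical in
/-- The sets `T_i`, `1 ≤ i ≤ r = N ^ tb(p)`, indexed by the labelings `i` of the through-blocks:
all valid labelings of the upper row that restrict to `i` on the through-blocks. -/
def T {N : ℕ} (i : p.ThroughBlock → Fin N) : Finset (Fin p.k → Fin N) :=
  {t | p.ValidUpper t ∧
    ∀ (b : p.ThroughBlock) (s : Fin p.k), Quotient.mk p.rel (Sum.inl s) = b.1 → t s = i b}

open Classical in
/-- The sets `T'_i`: all valid labelings of the lower row that restrict to `i` on the
through-blocks. -/
def T' {N : ℕ} (i : p.ThroughBlock → Fin N) : Finset (Fin p.l → Fin N) :=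
  {t | p.ValidLower t ∧
    ∀ (b : p.ThroughBlock) (s : Fin p.l), Quotient.mk p.rel (Sum.inr s) = b.1 → t s = i b}

variable {p}

lemma mem_T {N : ℕ} (i : p.ThroughBlock → Fin N) {t : Fin p.k → Fin N} :
    t ∈ p.T i ↔ p.ValidUpper t ∧ ∀ (b : p.ThroughBlock) (s : Fin p.k),
      Quotient.mk p.rel (Sum.inl s) = b.1 → t s = i b := by
  simp [T]

lemma mem_T' {N : ℕ} (i : p.ThroughBlock → Fin N) {t : Fin p.l → Fin N} :
    t ∈ p.T' i ↔ p.ValidLower t ∧ ∀ (b : p.ThroughBlock) (s : Fin p.l),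
      Quotient.mk p.rel (Sum.inr s) = b.1 → t s = i b := by
  simp [T']

end ColPartition

/-- The product `y_{s₁ t₁}^{ω₁} ⋯ y_{sₙ tₙ}^{ωₙ}`; it is `1` for `n = 0`. -/
def wordProd {A : Type*} [Ring A] [Star A] {N d n : ℕ} (y : Fin N → Fin d → A)
    (ω : Fin n → Color) (s : Fin n → Fin N) (t : Fin n → Fin d) : A :=
  (List.ofFn fun a => (ω a).act (y (s a) (t a))).prod

/-- The quantum group relations `R^Gr_p(u)`; a pair `(a, b)` stands for the relation `a = b`. -/
inductive GrRel {A : Type*} [Ring A] [Star A] {N : ℕ} (p : ColPartition) (u : Fin N → Fin N → A) :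
    A × A → Prop
  | both (i j : p.ThroughBlock → Fin N) (γ : Fin p.k → Fin N) (γ' : Fin p.l → Fin N)
      (hγ : γ ∈ p.T j) (hγ' : γ' ∈ p.T' i) :
      GrRel p u (∑ t ∈ p.T i, wordProd u p.upper t γ, ∑ t' ∈ p.T' j, wordProd u p.lower γ' t')
  | upper (i : p.ThroughBlock → Fin N) (γ : Fin p.k → Fin N) (hγ : ¬ p.ValidUpper γ) :
      GrRel p u (∑ t ∈ p.T i, wordProd u p.upper t γ, 0)
  | lower (j : p.ThroughBlock → Fin N) (γ' : Fin p.l → Fin N) (hγ' : ¬ p.ValidLower γ') :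
      GrRel p u (∑ t' ∈ p.T' j, wordProd u p.lower γ' t', 0)

/-- The quantum space relations `R^Sp_p(x)` for a `d`-tuple `x = (x_{ij})` of vectors; a pair
`(a, b)` stands for the relation `a = b`. The column indices in `[d]` are regarded as elements of
`[N]` via `d ≤ N`. -/
inductive SpRel {A : Type*} [Ring A] [Star A] {N d : ℕ} (h : d ≤ N) (p : ColPartition)
    (x : Fin N → Fin d → A) : A × A → Prop
  | both (i j : p.ThroughBlock → Fin N) (γ : Fin p.k → Fin d) (γ' : Fin p.l → Fin d)
      (hγ : Fin.castLE h ∘ γ ∈ p.T j) (hγ' : Fin.castLE h ∘ γ' ∈ p.T' j) :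
      SpRel h p x
        (∑ t ∈ p.T i, wordProd x p.upper t γ, ∑ t' ∈ p.T' i, wordProd x p.lower t' γ')
  | upper (i : p.ThroughBlock → Fin N) (γ : Fin p.k → Fin d)
      (hγ : ¬ p.ValidUpper (Fin.castLE h ∘ γ)) :
      SpRel h p x (∑ t ∈ p.T i, wordProd x p.upper t γ, 0)
  | lower (i : p.ThroughBlock → Fin N) (γ' : Fin p.l → Fin d)
      (hγ' : ¬ p.ValidLower (Fin.castLE h ∘ γ')) :
      SpRel h p x (∑ t' ∈ p.T' i, wordProd x p.lower t' γ', 0)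

/-- The relations `R^Gr_p(u)`, `p ∈ Π`, for the generators `u_{ij}`. -/
def easyRelations (N : ℕ) (P : Set ColPartition) :
    Set (FreeStarAlg (Fin N × Fin N) × FreeStarAlg (Fin N × Fin N)) :=
  {r | ∃ p ∈ P, GrRel p (fun i j => FreeStarAlg.gen (i, j)) r}

/-- `C(G_N(Π))`, the universal C*-algebra of the easy quantum group. -/
abbrev EasyQG (N : ℕ) (P : Set ColPartition) : Type := UnivCStar (easyRelations N P)

/-- The matrix of generators of `C(G_N(Π))`. -/
def EasyQG.u (N : ℕ) (P : Set ColPartition) : Matrix (Fin N) (Fin N) (EasyQG N P) :=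
  fun i j => UnivCStar.gen (easyRelations N P) (i, j)

/-- The relations `R^Sp_p(x)`, `p ∈ Π`, for the generators `x_{ij}`. -/
def pqsRelations {N d : ℕ} (h : d ≤ N) (P : Set ColPartition) :
    Set (FreeStarAlg (Fin N × Fin d) × FreeStarAlg (Fin N × Fin d)) :=
  {r | ∃ p ∈ P, SpRel h p (fun i j => FreeStarAlg.gen (i, j)) r}

/-- `C(X_{N,d}(Π))`, the universal C*-algebra of the partition quantum space of `d` vectors. -/
abbrev PQS {N d : ℕ} (h : d ≤ N) (P : Set ColPartition) : Type := UnivCStar (pqsRelations h P)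

/-- The `d` vectors of generators of `C(X_{N,d}(Π))`. -/
def PQS.x {N d : ℕ} (h : d ≤ N) (P : Set ColPartition) : Matrix (Fin N) (Fin d) (PQS h P) :=
  fun i j => UnivCStar.gen (pqsRelations h P) (i, j)

/-! ### Existence of the universal C*-algebras -/

lemma norm_le_one_of_sum {A : Type*} [CStarAlgebra A] {ι : Type*} [Fintype ι] (a : ι → A)
    (h : ∑ i, a i * star (a i) = 1) (i : ι) : ‖a i‖ ≤ 1 := by
  let _ := CStarAlgebra.spectralOrder A
  have := CStarAlgebra.spectralOrderedRing A
  rcases subsingleton_or_nontrivial A with hA | hA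
  · simp [Subsingleton.elim (a i) 0]
  have h1 : a i * star (a i) ≤ 1 := by
    rw [← h]
    exact Finset.single_le_sum (f := fun i => a i * star (a i))
      (fun j _ => mul_star_self_nonneg (a j)) (Finset.mem_univ i)
  have h2 := CStarAlgebra.norm_le_norm_of_nonneg_of_le (mul_star_self_nonneg (a i)) h1
  rw [CStarRing.norm_self_mul_star, norm_one] at h2
  nlinarith [norm_nonneg (a i)]

lemma CStarSeminorm.sum_eq_one {F : Type*} [Ring F] [StarRing F] [Algebra ℂ F] [StarModule ℂ F]
    (p : CStarSeminorm F) {ι : Type*} [Fintype ι] (a : ι → F)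
    (h : p (1 - ∑ i, a i * star (a i)) = 0) :
    ∑ i, p.toComplHom (a i) * star (p.toComplHom (a i)) = 1 := by
  rw [← p.norm_toCompl, norm_eq_zero] at h
  change p.toComplHom _ = 0 at h
  rw [map_sub, sub_eq_zero, map_one, map_sum] at h
  rw [h]
  simp [map_mul, map_star]

lemma FreeStarAlg.star_gen {X : Type u} (g : X) :
    star (gen g) = mon (FreeMonoid.of (g, true)) 1 := by
  simp [gen, star_mon, wordStar]

/-- A family of C*-seminorms on the free *-algebra that is bounded on the generators is pointwise
bounded. -/
lemma FreeStarAlg.bddAbove {X : Type u} (S : Set (CStarSeminorm (FreeStarAlg X)))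
    (h : ∀ p ∈ S, ∀ g, p (gen g) ≤ 1) (f : FreeStarAlg X) :
    BddAbove (Set.range fun p : S => p.1 f) := by
  suffices H : ∃ C, ∀ p ∈ S, p f ≤ C by
    obtain ⟨C, hC⟩ := H
    exact ⟨C, by rintro _ ⟨p, rfl⟩; exact hC p.1 p.2⟩
  induction f using induction_mon with
  | zero => exact ⟨0, fun p _ => (map_zero p.toSeminorm).le⟩
  | add f g hf hg =>
    obtain ⟨C, hC⟩ := hf
    obtain ⟨D, hD⟩ := hg
    exact ⟨C + D, fun p hp => (map_add_le_add p.toSeminorm f g).trans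
      (add_le_add (hC p hp) (hD p hp))⟩
  | mon w c =>
    refine ⟨‖c‖, fun p hp => ?_⟩
    have hw : p (mon w 1) ≤ 1 := by
      induction w using FreeMonoid.inductionOn' with
      | one =>
        have : p (mon 1 1 : FreeStarAlg X) = p (mon 1 1 : FreeStarAlg X) ^ 2 := by
          rw [← p.star_mul_self, star_mon, mon_mul]; simp [wordStar]
        nlinarith [p.nonneg (mon 1 1 : FreeStarAlg X)]
      | of_mul a w ih =>
        have e : mon (FreeMonoid.of a * w) 1 = mon (FreeMonoid.of a) 1 * mon w 1 := by
          rw [mon_mul, one_mul]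
        have ha : p (mon (FreeMonoid.of a) 1) ≤ 1 := by
          obtain ⟨g, b⟩ := a
          cases b
          · exact h p hp g
          · rw [← star_gen, p.star_eq]; exact h p hp g
        rw [e]
        exact (p.mul_le _ _).trans (mul_le_one₀ ha (p.nonneg _) ih)
    have e : mon w c = c • mon w 1 := by rw [smul_mon, mul_one]
    rw [e, map_smul_eq_mul]
    exact mul_le_of_le_one_right (norm_nonneg c) hw

namespace ColPartition

lemma lowerPair_throughBlock {a b : Color} (x : (lowerPair a b).ThroughBlock) : False :=
  Fin.elim0 x.2.1.choose

lemma mem_T_lowerPair {N : ℕ} {a b : Color} (i : (lowerPair a b).ThroughBlock → Fin N)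
    (t : Fin (lowerPair a b).k → Fin N) : t ∈ (lowerPair a b).T i :=
  (mem_T _).2 ⟨fun s => Fin.elim0 s, fun x => (lowerPair_throughBlock x).elim⟩

lemma const_mem_T'_lowerPair {N : ℕ} {a b : Color} (i : (lowerPair a b).ThroughBlock → Fin N)
    (s : Fin N) : (fun _ => s) ∈ (lowerPair a b).T' i :=
  (mem_T' _).2 ⟨fun _ _ _ => rfl, fun x => (lowerPair_throughBlock x).elim⟩

lemma sum_T'_lowerPair {N : ℕ} {M : Type*} [AddCommMonoid M] {a b : Color}
    (i : (lowerPair a b).ThroughBlock → Fin N) (f : (Fin (lowerPair a b).l → Fin N) → M) :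
    ∑ t ∈ (lowerPair a b).T' i, f t = ∑ s : Fin N, f (fun _ => s) := by
  symm
  refine Finset.sum_bij (fun s _ => fun _ => s) (fun s _ => const_mem_T'_lowerPair i s)
    (fun s _ s' _ h => congrFun h (0 : Fin 2)) (fun t ht => ?_) (fun _ _ => rfl)
  refine ⟨t (0 : Fin 2), Finset.mem_univ _, ?_⟩
  funext s
  exact ((mem_T' _).1 ht).1 (0 : Fin 2) s trivial

lemma sum_T_lowerPair {N : ℕ} {M : Type*} [AddCommMonoid M] {a b : Color}
    (i : (lowerPair a b).ThroughBlock → Fin N) (f : (Fin (lowerPair a b).k → Fin N) → M) :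
    ∑ t ∈ (lowerPair a b).T i, f t = f (fun s => Fin.elim0 s) := by
  rw [Finset.sum_eq_single_of_mem _ (mem_T_lowerPair i _)]
  intro t _ ht
  exact (ht (funext fun s => Fin.elim0 s)).elim

end ColPartition

/-- The C*-seminorms on the free *-algebra for which the quantum space relations hold are
pointwise bounded, so that the universal C*-algebra `C(X_{N,d}(Π))` exists. -/
lemma pqs_bddAbove {N d : ℕ} (h : d ≤ N) (P : Set ColPartition)
    (hP : ColPartition.mixedPairs ⊆ P) (f : FreeStarAlg (Fin N × Fin d)) :
    BddAbove (Set.range fun p : {p : CStarSeminorm (FreeStarAlg (Fin N × Fin d)) |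
      ∀ r ∈ pqsRelations h P, p (r.1 - r.2) = 0} => p.1 f) := by
  refine FreeStarAlg.bddAbove _ (fun p hp g => ?_) f
  obtain ⟨i, j⟩ := g
  have hr := hp _ ⟨ColPartition.lowerPair .white .black, hP (by simp [ColPartition.mixedPairs]),
    SpRel.both (fun x => (ColPartition.lowerPair_throughBlock x).elim)
      (fun x => (ColPartition.lowerPair_throughBlock x).elim) (fun s => Fin.elim0 s) (fun _ => j)
      (ColPartition.mem_T_lowerPair _ _) (ColPartition.const_mem_T'_lowerPair _ _)⟩
  rw [ColPartition.sum_T'_lowerPair, ColPartition.sum_T_lowerPair] at hr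
  rw [← p.norm_toCompl]
  refine norm_le_one_of_sum (fun s => p.toComplHom (FreeStarAlg.gen (s, j))) ?_ i
  exact p.sum_eq_one (fun s => FreeStarAlg.gen (s, j)) (by
    simpa [wordProd, ColPartition.lowerPair, Color.act, List.ofFn_succ] using hr)

/-- The C*-seminorms on the free *-algebra for which the quantum group relations hold are
pointwise bounded, so that the universal C*-algebra `C(G_N(Π))` exists. -/
lemma easy_bddAbove (N : ℕ) (P : Set ColPartition)
    (hP : ColPartition.mixedPairs ⊆ P) (f : FreeStarAlg (Fin N × Fin N)) :
    BddAbove (Set.range fun p : {p : CStarSeminorm (FreeStarAlg (Fin N × Fin N)) |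
      ∀ r ∈ easyRelations N P, p (r.1 - r.2) = 0} => p.1 f) := by
  refine FreeStarAlg.bddAbove _ (fun p hp g => ?_) f
  obtain ⟨i, j⟩ := g
  have hr := hp _ ⟨ColPartition.lowerPair .white .black, hP (by simp [ColPartition.mixedPairs]),
    GrRel.both (fun x => (ColPartition.lowerPair_throughBlock x).elim)
      (fun x => (ColPartition.lowerPair_throughBlock x).elim) (fun s => Fin.elim0 s) (fun _ => i)
      (ColPartition.mem_T_lowerPair _ _) (ColPartition.const_mem_T'_lowerPair _ _)⟩
  rw [ColPartition.sum_T'_lowerPair, ColPartition.sum_T_lowerPair] at hr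
  rw [← p.norm_toCompl]
  refine norm_le_one_of_sum (fun s => p.toComplHom (FreeStarAlg.gen (i, s))) ?_ j
  exact p.sum_eq_one (fun s => FreeStarAlg.gen (i, s)) (by
    simpa [wordProd, ColPartition.lowerPair, Color.act, List.ofFn_succ] using hr)

/-! ### Compact matrix quantum groups and their actions -/

/-- `u` is the fundamental matrix of a compact matrix quantum group `G` with `C(G) = A`. -/
structure IsCMQG {A : Type u} [CStarAlgebra A] {N : ℕ} (u : Matrix (Fin N) (Fin N) A) : Prop where
  generates : (StarAlgebra.adjoin ℂ {a : A | ∃ i j, a = u i j}).topologicalClosure = ⊤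
  isUnit : IsUnit u
  isUnit_conj : IsUnit (u.map star)
  comul : ∃ Δ : A →⋆ₐ[ℂ] MinTensor A A, ∀ i j, Δ (u i j) = ∑ k, minTmul (u i k) (u k j)

/-- The existence of a left matrix-vector action
`α(x_{ij}) = ∑ₖ u_{ik} ⊗ x_{kj}`. -/
def HasLeftAction {A : Type u} {B : Type v} [CStarAlgebra A] [CStarAlgebra B] {N d : ℕ}
    (u : Matrix (Fin N) (Fin N) A) (x : Matrix (Fin N) (Fin d) B) : Prop :=
  ∃ α : B →⋆ₐ[ℂ] MinTensor A B, ∀ i j, α (x i j) = ∑ k, minTmul (u i k) (x k j)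

/-- The existence of a right matrix-vector action
`β(x_{ij}) = ∑ₖ u_{ki} ⊗ x_{kj}`. -/
def HasRightAction {A : Type u} {B : Type v} [CStarAlgebra A] [CStarAlgebra B] {N d : ℕ}
    (u : Matrix (Fin N) (Fin N) A) (x : Matrix (Fin N) (Fin d) B) : Prop :=
  ∃ β : B →⋆ₐ[ℂ] MinTensor A B, ∀ i j, β (x i j) = ∑ k, minTmul (u k i) (x k j)

/-- The compact matrix quantum group with fundamental matrix `u` is the quantum symmetry group
of the quantum space with vectors of generators `x`: it acts from the left and from the right,
and it contains every compact matrix quantum group `G'` (with `C(G')` in the universe `w`) that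
does so, i.e. there is a *-homomorphism `C(G) → C(G')` mapping the fundamental matrix of `G`
entrywise to that of `G'`. -/
structure IsQuantumSymmetryGroup {A : Type u} {B : Type v} [CStarAlgebra A] [CStarAlgebra B]
    {N d : ℕ} (u : Matrix (Fin N) (Fin N) A) (x : Matrix (Fin N) (Fin d) B) : Prop where
  isCMQG : IsCMQG u
  left : HasLeftAction u x
  right : HasRightAction u x
  maximal : ∀ (A' : Type w) [CStarAlgebra A'] (v : Matrix (Fin N) (Fin N) A'),
    IsCMQG v → HasLeftAction v x → HasRightAction v x →
      ∃ φ : A →⋆ₐ[ℂ] A', ∀ i j, φ (u i j) = v i j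

end

/-! For a partition p let K and K' be the 0/1 matrices whose rows are the indicators of the sets T_i
and T'_i, and let U and U' be the matrices of upper and lower words in the entries of u. The group
relations say that a matrix Z exists with K U = Z K and U' K'ᵀ = K'ᵀ Z (`satisfiesGr_iff`). The
space relations say that a matrix Y exists with K U = Y K and K' U' = Y K' (`satisfiesSp_iff`).
Since the T_i are disjoint and of equal size c ≠ 0, K Kᵀ = c, and likewise for K'.

The group acts: the mixed pairs make u and its conjugate unitary, hence also U and U'. Then Z is
unitary, and taking adjoints supplies the two missing equations U Kᵀ = Kᵀ Z and K' U' = Z K'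
(`SatisfiesGr.exists_intertwiner`). So both u and its transpose satisfy the space relations.
Intertwiners multiply along products of matrices with commuting entries, so the matrices with
entries ∑ u_ik ⊗ x_kj and ∑ u_ki ⊗ x_kj satisfy the space relations too, and the universal property
gives the two actions. The comultiplication arises in the same way.

The group is maximal: the identity matrix satisfies the space relations, so C(X) has the character ε
with ε(x_ij) = δ_ij. Applying id ⊗ ε to the two actions of a group with matrix v shows that v and vᵀ
satisfy the space relations. For the upper row this yields K V = Y K and V Kᵀ = Kᵀ W; computing K V
Kᵀ in two ways gives Y = W, so the upper equation for v and the lower one for vᵀ together are the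
group relations (`SatisfiesSp.satisfiesGr`). The analytic input is that id ⊗ ε is bounded for the
minimal norm (`norm_algSlice_le`), which rests on norming GNS representations.

Uniqueness follows by applying maximality in both directions, as *-homomorphisms are determined on
the generators. -/

noncomputable section

/-! ### Norm-attaining states and GNS representations. -/

section GelfandNaimark

open scoped ComplexOrder

variable {A : Type u} [CStarAlgebra A]

/-- A norm one functional that is `1` at the unit is real on selfadjoint elements. -/
lemma StrongDual.im_apply_eq_zero_of_isSelfAdjoint (g : StrongDual ℂ A) (hg : ‖g‖ ≤ 1)
    (h1 : g 1 = 1) {a : A} (ha : IsSelfAdjoint a) : (g a).im = 0 := by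
  -- Shift by it: ‖a + it‖² ≤ ‖a‖² + t², whereas |g(a) + it|² contains the cross term 2t Im g(a). A
  -- bound on this term for all real t forces Im g(a) = 0.
  have key : ∀ t : ℝ, 2 * t * (g a).im ≤ ‖a‖ ^ 2 := fun t => by
    have e : star (a + (Complex.I * t) • (1 : A)) * (a + (Complex.I * t) • (1 : A))
        = star a * a + ((t ^ 2 : ℝ) : ℂ) • (1 : A) := by
      simp only [star_add, star_smul, star_one, ha.star_eq, mul_add, add_mul, mul_one,
        smul_mul_assoc, one_mul, mul_smul_comm]
      have h2 : (Complex.I * (t : ℂ)) * -(Complex.I * t) = ((t ^ 2 : ℝ) : ℂ) := by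
        push_cast
        linear_combination (-(t : ℂ) ^ 2) * Complex.I_mul_I
      have h3 : star (Complex.I * (t : ℂ)) = -(Complex.I * t) := by simp
      rw [h3, smul_add, smul_smul, h2, neg_smul]
      abel
    have n1 : ‖(1 : A)‖ ≤ 1 := by
      rcases subsingleton_or_nontrivial A with hA | hA
      · simp [Subsingleton.elim (1 : A) 0]
      · simp
    have n : ‖a + (Complex.I * t) • (1 : A)‖ ^ 2 ≤ ‖a‖ ^ 2 + t ^ 2 := by
      rw [sq, ← CStarRing.norm_star_mul_self, e]
      refine (norm_add_le _ _).trans ?_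
      rw [CStarRing.norm_star_mul_self, norm_smul, Complex.norm_real,
        Real.norm_of_nonneg (sq_nonneg t)]
      nlinarith [sq_nonneg t]
    have m : ‖g (a + (Complex.I * t) • (1 : A))‖ ^ 2 ≤ ‖a‖ ^ 2 + t ^ 2 := by
      refine le_trans (pow_le_pow_left₀ (norm_nonneg _) ?_ 2) n
      exact (g.le_opNorm _).trans (mul_le_of_le_one_left (norm_nonneg _) hg)
    rw [map_add, map_smul, h1, smul_eq_mul, mul_one] at m
    have i : ((g a).im + t) ^ 2 ≤ ‖g a + Complex.I * t‖ ^ 2 := by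
      rw [← Complex.normSq_eq_norm_sq, Complex.normSq_apply]
      simp only [Complex.add_re, Complex.add_im, Complex.mul_re, Complex.mul_im, Complex.I_re,
        Complex.I_im, Complex.ofReal_re, Complex.ofReal_im]
      ring_nf
      nlinarith [sq_nonneg (g a).re]
    nlinarith [sq_nonneg (g a).im]
  by_contra hne
  have := key ((‖a‖ ^ 2 + 1) / (2 * (g a).im))
  have e : 2 * ((‖a‖ ^ 2 + 1) / (2 * (g a).im)) * (g a).im = ‖a‖ ^ 2 + 1 := by field_simp
  linarith

variable [PartialOrder A] [StarOrderedRing A]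

/-- A norm one functional that is `1` at the unit is positive. -/
lemma StrongDual.apply_nonneg_of_norm_le_one (g : StrongDual ℂ A) (hg : ‖g‖ ≤ 1)
    (h1 : g 1 = 1) {a : A} (ha : 0 ≤ a) : 0 ≤ g a := by
  have hs : IsSelfAdjoint a := .of_nonneg ha
  refine Complex.nonneg_iff.2 ⟨?_, (g.im_apply_eq_zero_of_isSelfAdjoint hg h1 hs).symm⟩
  -- From 0 ≤ ‖a‖ - a ≤ ‖a‖ one gets |‖a‖ - g(a)| ≤ ‖a‖, which is impossible if Re g(a) < 0.
  have hle : a ≤ algebraMap ℝ A ‖a‖ := hs.le_algebraMap_norm_self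
  have hn : ‖algebraMap ℝ A ‖a‖ - a‖ ≤ ‖a‖ := by
    refine (CStarAlgebra.norm_le_norm_of_nonneg_of_le (sub_nonneg.2 hle)
      (sub_le_self _ ha)).trans ?_
    rcases subsingleton_or_nontrivial A with hA | hA
    · simp [Subsingleton.elim a 0]
    · simp
  have hga : ‖g (algebraMap ℝ A ‖a‖ - a)‖ ≤ ‖a‖ :=
    (g.le_opNorm _).trans ((mul_le_of_le_one_left (norm_nonneg _) hg).trans hn)
  have e : g (algebraMap ℝ A ‖a‖) = (‖a‖ : ℂ) := by
    rw [IsScalarTower.algebraMap_apply ℝ ℂ A, Algebra.algebraMap_eq_smul_one, map_smul, h1]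
    simp
  rw [map_sub, e] at hga
  have := (Complex.abs_re_le_norm _).trans hga
  rw [abs_le] at this
  simp only [Complex.sub_re, Complex.ofReal_re] at this
  linarith [this.2]

/-- The norm of a positive element lies in its spectrum, so 1 + ‖a‖ lies in the spectrum of 1 + a.
-/
lemma CStarAlgebra.norm_one_add_of_nonneg [Nontrivial A] {a : A} (ha : 0 ≤ a) :
    ‖1 + a‖ = 1 + ‖a‖ := by
  refine le_antisymm (by simpa using norm_add_le (1 : A) a) ?_
  have h := CStarAlgebra.norm_mem_spectrum_of_nonneg ha
  have h2 : 1 + ‖a‖ ∈ spectrum ℝ (1 + a) := by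
    have := spectrum.add_mem_add_iff (R := ℝ) (s := 1) (r := ‖a‖) (a := a)
    simp only [map_one] at this
    rw [add_comm 1 ‖a‖]
    exact this.2 h
  have := spectrum.norm_le_norm_of_mem h2
  rwa [Real.norm_of_nonneg (by positivity)] at this

/-- For each element of a unital C*-algebra there is a state that attains its norm. -/
lemma exists_state_apply_star_mul_self [Nontrivial A] (a : A) :
    ∃ f : A →ₚ[ℂ] ℂ, f 1 = 1 ∧ f (star a * a) = (‖a‖ ^ 2 : ℝ) := by
  set b := star a * a with hb
  have hb0 : 0 ≤ b := star_mul_self_nonneg a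
  have hn := CStarAlgebra.norm_one_add_of_nonneg hb0
  -- Norming 1 + b instead of b: in g(1) + g(b) = 1 + ‖b‖ both summands must be maximal, so the same
  -- functional satisfies g(1) = 1, hence is a state, and norms b.
  obtain ⟨g, hg, hgb⟩ := exists_dual_vector ℂ (1 + b) (by rw [hn]; positivity)
  rw [hn, map_add] at hgb
  have r1 : ‖g 1‖ ≤ 1 := by simpa [hg] using g.le_opNorm 1
  have rb : ‖g b‖ ≤ ‖b‖ := by simpa [hg] using g.le_opNorm b
  have hre := congrArg Complex.re hgb
  simp only [Complex.add_re, RCLike.ofReal_eq_complex_ofReal, Complex.ofReal_re] at hre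
  have h1 : g 1 = 1 := by
    have hr : (g 1).re = 1 := by
      linarith [Complex.re_le_norm (g 1), Complex.re_le_norm (g b)]
    have hs : ‖g 1‖ ^ 2 ≤ 1 := pow_le_one₀ (norm_nonneg _) r1
    rw [← Complex.normSq_eq_norm_sq, Complex.normSq_apply, hr] at hs
    exact Complex.ext hr (by simpa using (by nlinarith : (g 1).im * (g 1).im = 0))
  have h2 : g b = (‖b‖ : ℂ) := by
    rw [h1] at hgb
    simpa using hgb
  refine ⟨PositiveLinearMap.mk₀ g.toLinearMap
    fun x hx => g.apply_nonneg_of_norm_le_one hg.le h1 hx, h1, ?_⟩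
  change g b = _
  rw [h2, hb, CStarRing.norm_star_mul_self, sq]

end GelfandNaimark

/-- Representations on Hilbert spaces in the universe of a C*-algebra determine the norm. -/
lemma exists_representation_norm_le {A : Type u} [CStarAlgebra A] (a : A) :
    ∃ (H : Type u) (_ : NormedAddCommGroup H) (_ : InnerProductSpace ℂ H)
      (_ : CompleteSpace H) (π : A →⋆ₐ[ℂ] (H →L[ℂ] H)), ‖a‖ ≤ ‖π a‖ := by
  let _ := CStarAlgebra.spectralOrder A
  have := CStarAlgebra.spectralOrderedRing A
  rcases subsingleton_or_nontrivial A with hA | hA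
  -- The zero algebra has no states; it is represented on the zero space.
  · refine ⟨PUnit, inferInstance, inferInstance, inferInstance,
      ⟨⟨⟨⟨⟨0, Subsingleton.elim _ _⟩, fun _ _ => Subsingleton.elim _ _⟩, Subsingleton.elim _ _,
        fun _ _ => Subsingleton.elim _ _⟩, fun _ => Subsingleton.elim _ _⟩,
        fun _ => Subsingleton.elim _ _⟩, ?_⟩
    simp [Subsingleton.elim a 0]
  obtain ⟨f, hf1, hfa⟩ := exists_state_apply_star_mul_self a
  refine ⟨f.GNS, inferInstance, inferInstance, inferInstance, f.gnsStarAlgHom, ?_⟩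
  -- The class of 1 is a unit vector, and its image, the class of a, has norm f(a* a)^(1/2) = ‖a‖.
  have h := (f.gnsStarAlgHom a).le_opNorm (f.toPreGNS 1 : f.GNS)
  have e1 : ‖(f.toPreGNS 1 : f.GNS)‖ = 1 := by
    rw [UniformSpace.Completion.norm_coe, PositiveLinearMap.preGNS_norm_def]
    simp [hf1]
  have e2 : ‖f.gnsStarAlgHom a (f.toPreGNS 1 : f.GNS)‖ = ‖a‖ := by
    have : f.gnsStarAlgHom a (f.toPreGNS 1 : f.GNS) = (f.toPreGNS a : f.GNS) := by
      simp
    rw [this, UniformSpace.Completion.norm_coe, PositiveLinearMap.preGNS_norm_def]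
    simp only [PositiveLinearMap.ofPreGNS_toPreGNS, hfa, Complex.ofReal_re]
    exact Real.sqrt_sq (norm_nonneg a)
  rwa [e1, e2, mul_one] at h

/-! ### Suprema of C*-seminorms and extension to completions. -/

namespace CStarSeminorm

variable {F : Type*} [Ring F] [StarRing F] [Algebra ℂ F]

lemma sup_apply {S : Set (CStarSeminorm F)} (h : ∀ a, BddAbove (Set.range fun p : S => p.1 a))
    (a : F) : sup S a = ⨆ p : S, p.1 a := by
  unfold sup
  rw [dif_pos h]
  rfl

lemma le_sup {S : Set (CStarSeminorm F)} (h : ∀ a, BddAbove (Set.range fun p : S => p.1 a))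
    {p : CStarSeminorm F} (hp : p ∈ S) (a : F) : p a ≤ sup S a := by
  rw [sup_apply h]
  exact le_ciSup (h a) ⟨p, hp⟩

/-- No boundedness is needed: the default value for an unbounded family is the zero seminorm. -/
lemma sup_eq_zero {S : Set (CStarSeminorm F)} {a : F} (h : ∀ p ∈ S, p a = 0) : sup S a = 0 := by
  unfold sup
  split_ifs with hS
  · change ⨆ p : S, p.1 a = 0
    simp only [fun p : S => h p.1 p.2]
    exact Real.iSup_const_zero
  · rfl

/-- The C*-seminorm `a ↦ ‖φ a‖` of a *-homomorphism to a C*-algebra. -/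
def ofHom {D : Type*} [CStarAlgebra D] (φ : F →⋆ₐ[ℂ] D) : CStarSeminorm F where
  toSeminorm := (normSeminorm ℂ D).comp φ.toAlgHom.toLinearMap
  mul_le a b := by simpa using norm_mul_le (φ a) (φ b)
  star_mul_self a := by
    change ‖φ (star a * a)‖ = ‖φ a‖ ^ 2
    rw [map_mul, map_star, CStarRing.norm_star_mul_self, sq]

lemma ofHom_apply {D : Type*} [CStarAlgebra D] (φ : F →⋆ₐ[ℂ] D) (a : F) : ofHom φ a = ‖φ a‖ := rfl

variable (p : CStarSeminorm F) {D : Type*} [CStarAlgebra D]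

lemma toComplHom_eq_iff (a b : F) : p.toComplHom a = p.toComplHom b ↔ p (a - b) = 0 := by
  rw [← sub_eq_zero, ← map_sub, ← norm_eq_zero]
  exact Eq.congr_left (p.norm_toCompl _)

variable [StarModule ℂ F]

/-- The extension to the completion of a *-homomorphism that is bounded by the seminorm. -/
lemma exists_lift (φ : F →⋆ₐ[ℂ] D) (h : ∀ a, ‖φ a‖ ≤ p a) :
    ∃ ψ : p.Completion →⋆ₐ[ℂ] D, ∀ a, ψ (p.toComplHom a) = φ a := by
  let φ' : p.Pre →+* D := (φ : F →+* D)
  have hc : Continuous φ' :=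
    AddMonoidHomClass.continuous_of_bound φ' 1 fun a => (h a).trans_eq (one_mul _).symm
  let ψ := UniformSpace.Completion.extensionHom φ' hc
  have hψ : ∀ a : F, ψ (p.toCompl a) = φ a := UniformSpace.Completion.extensionHom_coe φ' hc
  have hψc : Continuous ψ := UniformSpace.Completion.continuous_extension
  refine ⟨{ ψ with
    commutes' := fun c => ?_
    map_star' := fun x => ?_ }, hψ⟩
  · have e : algebraMap ℂ p.Completion c = p.toCompl (algebraMap ℂ F c) :=
      (AlgHomClass.commutes p.toComplHom c).symm
    change ψ (algebraMap ℂ p.Completion c) = _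
    rw [e, hψ]
    exact AlgHomClass.commutes φ c
  · change ψ (star x) = star (ψ x)
    have := p.continuous_star'
    refine p.denseRange_toCompl.induction_on (p := fun x => ψ (star x) = star (ψ x)) x
      (isClosed_eq (by fun_prop) (by fun_prop)) (fun a => ?_)
    rw [← toCompl_star, hψ, hψ, map_star]

end CStarSeminorm

/-! ### Slice maps on the minimal tensor product. -/

section Slice

variable {A : Type u} {B : Type v} [CStarAlgebra A] [CStarAlgebra B]

lemma tensorRepSeminorm_le_minTensorSeminorm {H : Type u} [NormedAddCommGroup H]
    [InnerProductSpace ℂ H] [CompleteSpace H] {K : Type v} [NormedAddCommGroup K]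
    [InnerProductSpace ℂ K] [CompleteSpace K] (π : A →⋆ₐ[ℂ] (H →L[ℂ] H))
    (ρ : B →⋆ₐ[ℂ] (K →L[ℂ] K)) (x : A ⊗[ℂ] B) :
    tensorRepSeminorm π ρ x ≤ minTensorSeminorm A B x := by
  refine CStarSeminorm.le_sup (fun x => ?_) ?_ x
  swap
  · exact ⟨H, _, _, _, K, _, _, _, π, ρ, rfl⟩
  obtain ⟨C, hC⟩ := minTensorSeminorm_bddAbove A B x
  refine ⟨C, ?_⟩
  rintro _ ⟨⟨_, H, _, _, _, K, _, _, _, π, ρ, rfl⟩, rfl⟩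
  exact hC H K π ρ

/-- The slice map `a ⊗ b ↦ ε b • a` on the algebraic tensor product. -/
def algSlice (ε : B →⋆ₐ[ℂ] ℂ) : A ⊗[ℂ] B →⋆ₐ[ℂ] A :=
  let L : A ⊗[ℂ] B →ₐ[ℂ] A := Algebra.TensorProduct.lift (AlgHom.id ℂ A)
    ((Algebra.ofId ℂ A).comp ε.toAlgHom) fun _ _ => (Algebra.commutes _ _).symm
  have hL : ∀ a b, L (a ⊗ₜ[ℂ] b) = ε b • a := fun a b => by
    change a * algebraMap ℂ A (ε b) = _
    rw [Algebra.algebraMap_eq_smul_one, mul_smul_comm, mul_one]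
  { L with
    map_star' := fun x => by
      change L (star x) = star (L x)
      induction x with
      | zero => simp
      | add x y hx hy => rw [star_add, map_add, hx, hy, map_add, star_add]
      | tmul a b => rw [TensorProduct.star_tmul, hL, hL, map_star, star_smul] }

lemma algSlice_tmul (ε : B →⋆ₐ[ℂ] ℂ) (a : A) (b : B) : algSlice ε (a ⊗ₜ[ℂ] b) = ε b • a := by
  change a * algebraMap ℂ A (ε b) = _
  rw [Algebra.algebraMap_eq_smul_one, mul_smul_comm, mul_one]

/-- The representation by scalars that is given by a character. -/
def charRep {K : Type v} [NormedAddCommGroup K] [InnerProductSpace ℂ K] [CompleteSpace K]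
    (ε : B →⋆ₐ[ℂ] ℂ) : B →⋆ₐ[ℂ] (K →L[ℂ] K) where
  __ := (Algebra.ofId ℂ (K →L[ℂ] K)).comp ε.toAlgHom
  map_star' b := by
    change algebraMap ℂ (K →L[ℂ] K) (ε (star b)) = star (algebraMap ℂ (K →L[ℂ] K) (ε b))
    rw [map_star, algebraMap_star_comm]

lemma charRep_apply {K : Type v} [NormedAddCommGroup K] [InnerProductSpace ℂ K] [CompleteSpace K]
    (ε : B →⋆ₐ[ℂ] ℂ) (b : B) (ξ : K) : charRep ε b ξ = ε b • ξ := by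
  change algebraMap ℂ (K →L[ℂ] K) (ε b) ξ = _
  simp [Algebra.algebraMap_eq_smul_one]

/-- Take π norming the sliced element and let B act by ε on a one-dimensional space. On H ⊗ ℂξ the
operator (π ⊗ ρ)(x) is π of the slice, so the norm of the slice is bounded by one of the seminorms
in the supremum. -/
lemma norm_algSlice_le (ε : B →⋆ₐ[ℂ] ℂ) (x : A ⊗[ℂ] B) :
    ‖algSlice ε x‖ ≤ minTensorSeminorm A B x := by
  obtain ⟨H, _, _, _, π, hπ⟩ := exists_representation_norm_le (algSlice ε x)
  -- A copy of ℂ in the universe of `B`, as the minimal norm only ranges over such spaces.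
  let ρ : B →⋆ₐ[ℂ] (EuclideanSpace ℂ PUnit.{v + 1} →L[ℂ] EuclideanSpace ℂ PUnit.{v + 1}) :=
    charRep ε
  let ξ : EuclideanSpace ℂ PUnit.{v + 1} := EuclideanSpace.single PUnit.unit 1
  have hξ : ‖ξ‖ = 1 := by simp [ξ]
  have key : ∀ (y : A ⊗[ℂ] B) (h : H), tensorRep π ρ y (h ⊗ₜ ξ) = π (algSlice ε y) h ⊗ₜ ξ := by
    intro y h
    induction y with
    | zero => simp
    | add y z hy hz =>
      rw [map_add, add_apply, hy, hz, map_add, map_add,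
        add_apply, TensorProduct.add_tmul]
    | tmul a b =>
      rw [tensorRep_tmul, TensorProduct.mapL_tmul, algSlice_tmul, charRep_apply, map_smul,
        smul_apply, TensorProduct.tmul_smul, TensorProduct.smul_tmul']
  refine hπ.trans (le_trans ?_ (tensorRepSeminorm_le_minTensorSeminorm π ρ x))
  refine ContinuousLinearMap.opNorm_le_bound _ ((tensorRepSeminorm π ρ).nonneg x) fun h => ?_
  have h1 := (tensorRep π ρ x).le_opNorm (h ⊗ₜ ξ)
  rw [key, TensorProduct.norm_tmul, TensorProduct.norm_tmul, hξ, mul_one, mul_one] at h1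
  exact h1

/-- The slice map `id ⊗ ε` on the minimal tensor product, for a character `ε`. -/
lemma exists_minSlice (A : Type u) [CStarAlgebra A] (ε : B →⋆ₐ[ℂ] ℂ) :
    ∃ σ : MinTensor A B →⋆ₐ[ℂ] A, ∀ a b, σ (minTmul a b) = ε b • a := by
  obtain ⟨σ, hσ⟩ := (minTensorSeminorm A B).exists_lift (algSlice ε) (norm_algSlice_le ε)
  exact ⟨σ, fun a b => (hσ _).trans (algSlice_tmul ε a b)⟩

end Slice

/-! ### Universal properties of free *-algebras and universal C*-algebras. -/

namespace FreeStarAlg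

variable {X : Type u} {D : Type v} [CStarAlgebra D]

/-- The value of a letter under an assignment of the generators. -/
def letterVal (y : X → D) (a : X × Bool) : D := if a.2 then star (y a.1) else y a.1

lemma lift_wordStar (y : X → D) (w : FreeMonoid (X × Bool)) :
    FreeMonoid.lift (letterVal y) (wordStar w) = star (FreeMonoid.lift (letterVal y) w) := by
  induction w using FreeMonoid.inductionOn' with
  | one => simp [wordStar]
  | of_mul a w ih =>
    obtain ⟨g, b⟩ := a
    rw [wordStar_mul, map_mul, ih, map_mul, star_mul]
    congr 1
    cases b <;> simp [wordStar, letterVal]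

/-- The *-homomorphism from the free *-algebra that extends an assignment of the generators. -/
def lift (y : X → D) : FreeStarAlg X →⋆ₐ[ℂ] D where
  __ := (MonoidAlgebra.lift ℂ D (FreeMonoid (X × Bool)) (FreeMonoid.lift (letterVal y)) :
    MonoidAlgebra ℂ (FreeMonoid (X × Bool)) →ₐ[ℂ] D)
  map_star' f := by
    let L : FreeStarAlg X →ₐ[ℂ] D :=
      MonoidAlgebra.lift ℂ D (FreeMonoid (X × Bool)) (FreeMonoid.lift (letterVal y))
    have hL : ∀ w c, L (mon w c) = c • FreeMonoid.lift (letterVal y) w := fun w c =>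
      MonoidAlgebra.lift_single _ _ _
    change L (star f) = star (L f)
    induction f using induction_mon with
    | zero => simp
    | add f g hf hg => rw [star_add, map_add, hf, hg, map_add, star_add]
    | mon w c => rw [star_mon, hL, hL, lift_wordStar, star_smul]

lemma lift_gen (y : X → D) (g : X) : lift y (gen g) = y g := by
  refine (MonoidAlgebra.lift_single (R := ℂ) (A := D) (FreeMonoid.lift (letterVal y))
    (FreeMonoid.of (g, false)) 1).trans ?_
  simp [letterVal]

end FreeStarAlg

namespace UnivCStar

variable {X : Type u} {R : Set (FreeStarAlg X × FreeStarAlg X)}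

lemma toComplHom_eq_of_mem {r : FreeStarAlg X × FreeStarAlg X} (hr : r ∈ R) :
    (univSeminorm R).toComplHom r.1 = (univSeminorm R).toComplHom r.2 :=
  ((univSeminorm R).toComplHom_eq_iff _ _).2 (CStarSeminorm.sup_eq_zero fun _ hp => hp r hr)

/-- The universal property: if the relations have pointwise bounded C*-seminorms, then a family in
a C*-algebra that satisfies them is the image of the generators under a *-homomorphism. -/
lemma exists_hom (hR : ∀ f, BddAbove (Set.range fun p : {p : CStarSeminorm (FreeStarAlg X) |
      ∀ r ∈ R, p (r.1 - r.2) = 0} => p.1 f)) {D : Type v} [CStarAlgebra D] (y : X → D)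
    (hy : ∀ r ∈ R, FreeStarAlg.lift y r.1 = FreeStarAlg.lift y r.2) :
    ∃ φ : UnivCStar R →⋆ₐ[ℂ] D, ∀ g, φ (gen R g) = y g := by
  obtain ⟨φ, hφ⟩ := (univSeminorm R).exists_lift (FreeStarAlg.lift y)
    fun a => CStarSeminorm.le_sup (p := .ofHom (FreeStarAlg.lift y)) hR (fun r hr => by
      rw [CStarSeminorm.ofHom_apply, map_sub, hy r hr, sub_self, norm_zero]) a
  exact ⟨φ, fun g => (hφ _).trans (FreeStarAlg.lift_gen y g)⟩

/-- The free *-algebra has dense image and is spanned by words, which are products of generators and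
their adjoints. -/
lemma adjoin_gen_dense (R : Set (FreeStarAlg X × FreeStarAlg X)) :
    (StarAlgebra.adjoin ℂ (Set.range (gen R))).topologicalClosure = ⊤ := by
  rw [eq_top_iff]
  intro x _
  have hmem : ∀ f, (univSeminorm R).toComplHom f ∈ StarAlgebra.adjoin ℂ (Set.range (gen R)) := by
    intro f
    induction f using FreeStarAlg.induction_mon with
    | zero => rw [map_zero]; exact zero_mem _
    | add f g hf hg => rw [map_add]; exact add_mem hf hg
    | mon w c =>
      have e : FreeStarAlg.mon w c = c • FreeStarAlg.mon w 1 := by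
        rw [FreeStarAlg.smul_mon, mul_one]
      rw [e, map_smul]
      clear e
      refine SMulMemClass.smul_mem c ?_
      induction w using FreeMonoid.inductionOn' with
      | one => exact (map_one (univSeminorm R).toComplHom) ▸ one_mem _
      | of_mul a w ih =>
        have e : FreeStarAlg.mon (FreeMonoid.of a * w) 1
            = FreeStarAlg.mon (FreeMonoid.of a) 1 * FreeStarAlg.mon w 1 := by
          rw [FreeStarAlg.mon_mul, one_mul]
        rw [e, map_mul]
        refine mul_mem ?_ ih
        obtain ⟨g, b⟩ := a
        have hg : gen R g ∈ StarAlgebra.adjoin ℂ (Set.range (gen R)) :=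
          StarAlgebra.subset_adjoin ℂ _ ⟨g, rfl⟩
        cases b
        · exact hg
        · rw [← FreeStarAlg.star_gen, map_star]
          exact star_mem hg
  have := (univSeminorm R).denseRange_toCompl x
  exact closure_mono (Set.range_subset_iff.2 hmem) this

end UnivCStar

/-! ### Intertwiners given by incidence matrices of disjoint families. -/

section IncidenceMatrix

open Matrix

variable {ι τ τ' A : Type*} [DecidableEq τ] [DecidableEq τ']

/-- The incidence matrix of a family of finite sets. -/
def incMatrix (A : Type*) [Zero A] [One A] (T : ι → Finset τ) : Matrix ι τ A :=
  fun i t => if t ∈ T i then 1 else 0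

section Ring

variable [Ring A]

lemma incMatrix_mul_apply [Fintype τ] {σ : Type*} (T : ι → Finset τ) (X : Matrix τ σ A) (i : ι) (γ : σ) :
    (incMatrix A T * X) i γ = ∑ t ∈ T i, X t γ := by
  simp [incMatrix, mul_apply]

/-- Over a noncommutative ring transposition does not reverse products in general; it does here
because the entries 0 and 1 of one factor are central. -/
lemma transpose_mul_incMatrix [Fintype ι] {σ : Type*} (T : ι → Finset τ) (Y : Matrix σ ι A) :
    (Y * incMatrix A T)ᵀ = (incMatrix A T)ᵀ * Yᵀ := by
  ext γ i
  simp [incMatrix, mul_apply]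

lemma transpose_incMatrix_mul [Fintype τ] {σ : Type*} (T : ι → Finset τ) (X : Matrix τ σ A) :
    (incMatrix A T * X)ᵀ = Xᵀ * (incMatrix A T)ᵀ := by
  ext γ i
  simp [incMatrix, mul_apply]

/-- The rows are indicators of disjoint sets of size c. This is what allows K to be cancelled from
equations. -/
lemma incMatrix_mul_transpose [Fintype τ] [DecidableEq ι] {T : ι → Finset τ}
    (hT : ∀ i j t, t ∈ T i → t ∈ T j → i = j) {c : ℕ} (hc : ∀ i, (T i).card = c) :
    incMatrix A T * (incMatrix A T)ᵀ = c • (1 : Matrix ι ι A) := by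
  ext i j
  rw [incMatrix_mul_apply, Matrix.smul_apply, one_apply]
  simp only [incMatrix, transpose_apply]
  split_ifs with h
  · subst h
    rw [Finset.sum_congr rfl fun t ht => if_pos ht, Finset.sum_const, hc]
  · rw [Finset.sum_congr rfl fun t ht => if_neg fun ht' => h (hT i j t ht ht'),
      Finset.sum_const_zero, smul_zero]

variable [Fintype ι]

lemma mul_incMatrix_apply_of_mem {T : ι → Finset τ} (hT : ∀ i j t, t ∈ T i → t ∈ T j → i = j)
    (Y : Matrix ι ι A) (i : ι) {j : ι} {γ : τ} (hγ : γ ∈ T j) :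
    (Y * incMatrix A T) i γ = Y i j := by
  rw [mul_apply, Finset.sum_eq_single_of_mem j (Finset.mem_univ j)]
  · simp [incMatrix, hγ]
  · intro l _ hl
    rw [incMatrix, if_neg fun h => hl (hT l j γ h hγ), mul_zero]

lemma mul_incMatrix_apply_of_notMem {T : ι → Finset τ} (Y : Matrix ι ι A) (i : ι) {γ : τ}
    (hγ : ∀ j, γ ∉ T j) : (Y * incMatrix A T) i γ = 0 := by
  simp [mul_apply, incMatrix, hγ]

variable [Fintype τ]

/-- By disjointness column γ of Y K is column j of Y if γ ∈ T_j, and zero if γ is in no T_j. This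
translates the sum relations into one matrix equation. -/
lemma incMatrix_mul_eq_iff {T : ι → Finset τ} (hT : ∀ i j t, t ∈ T i → t ∈ T j → i = j)
    (X : Matrix τ τ A) (Y : Matrix ι ι A) :
    incMatrix A T * X = Y * incMatrix A T ↔
      (∀ i j, ∀ γ ∈ T j, ∑ t ∈ T i, X t γ = Y i j) ∧
        ∀ i γ, (∀ j, γ ∉ T j) → ∑ t ∈ T i, X t γ = 0 := by
  refine ⟨fun h => ⟨fun i j γ hγ => ?_, fun i γ hγ => ?_⟩, fun h => ?_⟩
  · rw [← incMatrix_mul_apply, h, mul_incMatrix_apply_of_mem hT Y i hγ]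
  · rw [← incMatrix_mul_apply, h, mul_incMatrix_apply_of_notMem Y i hγ]
  · ext i γ
    rw [incMatrix_mul_apply]
    by_cases hγ : ∃ j, γ ∈ T j
    · obtain ⟨j, hj⟩ := hγ
      rw [mul_incMatrix_apply_of_mem hT Y i hj, h.1 i j γ hj]
    · rw [not_exists] at hγ
      rw [mul_incMatrix_apply_of_notMem Y i hγ, h.2 i γ hγ]

lemma mul_transpose_incMatrix_eq_iff {T : ι → Finset τ}
    (hT : ∀ i j t, t ∈ T i → t ∈ T j → i = j) (X : Matrix τ τ A) (Y : Matrix ι ι A) :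
    X * (incMatrix A T)ᵀ = (incMatrix A T)ᵀ * Y ↔
      (∀ i j, ∀ γ ∈ T i, ∑ t ∈ T j, X γ t = Y i j) ∧
        ∀ j γ, (∀ i, γ ∉ T i) → ∑ t ∈ T j, X γ t = 0 := by
  rw [← transpose_transpose Y, ← transpose_mul_incMatrix, ← transpose_transpose X,
    ← transpose_incMatrix_mul, transpose_inj, incMatrix_mul_eq_iff hT]
  simp only [transpose_apply]
  exact and_congr ⟨fun h i j => h j i, fun h i j => h j i⟩ Iff.rfl

end Ring

section StarRing

variable [Ring A] [StarRing A]

lemma conjTranspose_incMatrix (T : ι → Finset τ) : (incMatrix A T)ᴴ = (incMatrix A T)ᵀ := by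
  ext t i
  simp only [conjTranspose_apply, transpose_apply, incMatrix]
  split_ifs <;> simp

lemma conjTranspose_transpose_incMatrix (T : ι → Finset τ) :
    ((incMatrix A T)ᵀ)ᴴ = incMatrix A T := by
  rw [← conjTranspose_incMatrix, conjTranspose_conjTranspose]

end StarRing

section Algebra

variable [Ring A] [Algebra ℂ A] [Fintype ι] [DecidableEq ι] [Fintype τ] [Fintype τ']

lemma Matrix.nsmul_cancel {m n : Type*} {c : ℕ} (hc : c ≠ 0) {X Y : Matrix m n A}
    (h : c • X = c • Y) : X = Y := by
  have hc' : (c : ℂ) ≠ 0 := by exact_mod_cast hc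
  rw [← Nat.cast_smul_eq_nsmul ℂ, ← Nat.cast_smul_eq_nsmul ℂ] at h
  exact smul_right_injective _ hc' h

/-- If `K X = Y K` and `X Kᵀ = Kᵀ Z` for an incidence matrix `K`, then `Y = Z`. -/
lemma incMatrix_intertwiner_unique {T : ι → Finset τ} (hT : ∀ i j t, t ∈ T i → t ∈ T j → i = j)
    {c : ℕ} (hc : ∀ i, (T i).card = c) (hc0 : c ≠ 0) {X : Matrix τ τ A} {Y Z : Matrix ι ι A}
    (hY : incMatrix A T * X = Y * incMatrix A T)
    (hZ : X * (incMatrix A T)ᵀ = (incMatrix A T)ᵀ * Z) : Y = Z := by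
  refine Matrix.nsmul_cancel hc0 ?_
  -- Both sides are K X Kᵀ; since K Kᵀ = c, this reads c Y = c Z.
  have h : Y * (incMatrix A T * (incMatrix A T)ᵀ) = (incMatrix A T * (incMatrix A T)ᵀ) * Z := by
    rw [← Matrix.mul_assoc, ← hY, Matrix.mul_assoc, hZ, Matrix.mul_assoc]
  rwa [incMatrix_mul_transpose hT hc, Matrix.mul_smul, Matrix.mul_one, Matrix.smul_mul,
    Matrix.one_mul] at h

/-- Unitary matrices that are intertwined by incidence matrices are also intertwined by the
transposes. -/
lemma incMatrix_intertwiner_of_unitary [StarRing A] {T : ι → Finset τ} {T' : ι → Finset τ'}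
    (hT : ∀ i j t, t ∈ T i → t ∈ T j → i = j) (hT' : ∀ i j t, t ∈ T' i → t ∈ T' j → i = j)
    {c c' : ℕ} (hc : ∀ i, (T i).card = c) (hc' : ∀ i, (T' i).card = c') (hc0 : c ≠ 0)
    (hc0' : c' ≠ 0) {X : Matrix τ τ A} {X' : Matrix τ' τ' A} {Z : Matrix ι ι A}
    (hX : X * Xᴴ = 1) (hX' : X'ᴴ * X' = 1)
    (h : incMatrix A T * X = Z * incMatrix A T)
    (h' : X' * (incMatrix A T')ᵀ = (incMatrix A T')ᵀ * Z) :
    X * (incMatrix A T)ᵀ = (incMatrix A T)ᵀ * Z ∧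
      incMatrix A T' * X' = Z * incMatrix A T' := by
  have hs := congrArg conjTranspose h
  have hs' := congrArg conjTranspose h'
  rw [conjTranspose_mul, conjTranspose_mul, conjTranspose_incMatrix] at hs
  rw [conjTranspose_mul, conjTranspose_mul, conjTranspose_transpose_incMatrix] at hs'
  -- Multiplying K X = Z K by its adjoint gives c = c Z Z*. The family T' gives the other half of
  -- the unitarity of Z, from X'* X' = 1.
  have z1 : Z * Zᴴ = 1 := by
    refine Matrix.nsmul_cancel hc0 ?_
    have e : incMatrix A T * X * (Xᴴ * (incMatrix A T)ᵀ)
        = Z * incMatrix A T * ((incMatrix A T)ᵀ * Zᴴ) := by rw [h, hs]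
    rw [Matrix.mul_assoc, ← Matrix.mul_assoc X, hX, Matrix.one_mul, Matrix.mul_assoc,
      ← Matrix.mul_assoc _ _ Zᴴ, incMatrix_mul_transpose hT hc, Matrix.smul_mul,
      Matrix.one_mul, Matrix.mul_smul] at e
    exact e.symm
  have z2 : Zᴴ * Z = 1 := by
    refine Matrix.nsmul_cancel hc0' ?_
    have e : incMatrix A T' * X'ᴴ * (X' * (incMatrix A T')ᵀ)
        = Zᴴ * incMatrix A T' * ((incMatrix A T')ᵀ * Z) := by rw [h', hs']
    rw [Matrix.mul_assoc, ← Matrix.mul_assoc X'ᴴ, hX', Matrix.one_mul, Matrix.mul_assoc,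
      ← Matrix.mul_assoc _ _ Z, incMatrix_mul_transpose hT' hc', Matrix.smul_mul,
      Matrix.one_mul, Matrix.mul_smul] at e
    exact e.symm
  constructor
  -- The adjoint equation Kᵀ Z* = X* Kᵀ is multiplied by X on the left and by Z on the right.
  · calc X * (incMatrix A T)ᵀ = X * ((incMatrix A T)ᵀ * Zᴴ) * Z := by
          rw [Matrix.mul_assoc, Matrix.mul_assoc, z2, Matrix.mul_one]
      _ = (incMatrix A T)ᵀ * Z := by rw [← hs, ← Matrix.mul_assoc X, hX, Matrix.one_mul]
  · calc incMatrix A T' * X' = Z * (Zᴴ * incMatrix A T') * X' := by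
          rw [← Matrix.mul_assoc, z1, Matrix.one_mul]
      _ = Z * incMatrix A T' := by
          rw [← hs', Matrix.mul_assoc, Matrix.mul_assoc, hX', Matrix.mul_one]

end Algebra

end IncidenceMatrix

/-! ### The sets of valid labelings: disjointness and equal size. -/

namespace ColPartition

variable (p : ColPartition) {N : ℕ}

instance : Finite p.ThroughBlock := inferInstanceAs (Finite (Subtype _))

instance : Fintype p.ThroughBlock := Fintype.ofFinite _

instance : DecidableEq p.ThroughBlock := Classical.decEq _

variable {p}

lemma T_unique (i j : p.ThroughBlock → Fin N) (t : Fin p.k → Fin N) (hi : t ∈ p.T i)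
    (hj : t ∈ p.T j) : i = j := by
  funext b
  obtain ⟨s, hs⟩ := b.2.1
  rw [← ((mem_T i).1 hi).2 b s hs, ← ((mem_T j).1 hj).2 b s hs]

lemma T'_unique (i j : p.ThroughBlock → Fin N) (t : Fin p.l → Fin N) (hi : t ∈ p.T' i)
    (hj : t ∈ p.T' j) : i = j := by
  funext b
  obtain ⟨s, hs⟩ := b.2.2
  rw [← ((mem_T' i).1 hi).2 b s hs, ← ((mem_T' j).1 hj).2 b s hs]

/-- A valid labeling is constant on every through-block, so it restricts to some i and lies in T_i.
-/
lemma forall_notMem_T_iff {t : Fin p.k → Fin N} : (∀ i, t ∉ p.T i) ↔ ¬ p.ValidUpper t := by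
  refine ⟨fun h hv => ?_, fun h i hi => h ((mem_T i).1 hi).1⟩
  refine h (fun b => t b.2.1.choose) ((mem_T _).2 ⟨hv, fun b s hs => hv _ _ ?_⟩)
  exact Quotient.exact (hs.trans b.2.1.choose_spec.symm)

lemma forall_notMem_T'_iff {t : Fin p.l → Fin N} : (∀ i, t ∉ p.T' i) ↔ ¬ p.ValidLower t := by
  refine ⟨fun h hv => ?_, fun h i hi => h ((mem_T' i).1 hi).1⟩
  refine h (fun b => t b.2.2.choose) ((mem_T' _).2 ⟨hv, fun b s hs => hv _ _ ?_⟩)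
  exact Quotient.exact (hs.trans b.2.2.choose_spec.symm)

open Classical in
/-- Relabeling of the points in through-blocks, for a row of points with blocks given by `q`. -/
def relabel {n : ℕ} (q : Fin n → Quotient p.rel) (i : p.ThroughBlock → Fin N)
    (t : Fin n → Fin N) : Fin n → Fin N := fun s =>
  if h : ∃ b : p.ThroughBlock, q s = b.1 then i h.choose else t s

lemma relabel_of_eq {n : ℕ} {q : Fin n → Quotient p.rel} {i : p.ThroughBlock → Fin N}
    {t : Fin n → Fin N} {s : Fin n} {b : p.ThroughBlock} (h : q s = b.1) :
    relabel q i t s = i b := by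
  have h' : ∃ b : p.ThroughBlock, q s = b.1 := ⟨b, h⟩
  rw [relabel, dif_pos h']
  exact congrArg i (Subtype.ext (h'.choose_spec.symm.trans h))

lemma relabel_of_ne {n : ℕ} {q : Fin n → Quotient p.rel} {i : p.ThroughBlock → Fin N}
    {t : Fin n → Fin N} {s : Fin n} (h : ¬ ∃ b : p.ThroughBlock, q s = b.1) :
    relabel q i t s = t s := dif_neg h

lemma relabel_eq_of_eq {n : ℕ} {q : Fin n → Quotient p.rel} {i : p.ThroughBlock → Fin N}
    {t : Fin n → Fin N} {s s' : Fin n} (h : q s = q s') (ht : t s = t s') :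
    relabel q i t s = relabel q i t s' := by
  by_cases hb : ∃ b : p.ThroughBlock, q s = b.1
  · obtain ⟨b, hb⟩ := hb
    rw [relabel_of_eq hb, relabel_of_eq (h.symm.trans hb)]
  · rw [relabel_of_ne hb, relabel_of_ne (by rwa [← h]), ht]

lemma relabel_mem_T (i : p.ThroughBlock → Fin N) {t : Fin p.k → Fin N} (ht : p.ValidUpper t) :
    relabel (fun s => Quotient.mk p.rel (Sum.inl s)) i t ∈ p.T i :=
  (mem_T i).2 ⟨fun s s' h => relabel_eq_of_eq (Quotient.sound h) (ht s s' h),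
    fun _ _ hs => relabel_of_eq hs⟩

lemma relabel_mem_T' (i : p.ThroughBlock → Fin N) {t : Fin p.l → Fin N} (ht : p.ValidLower t) :
    relabel (fun s => Quotient.mk p.rel (Sum.inr s)) i t ∈ p.T' i :=
  (mem_T' i).2 ⟨fun s s' h => relabel_eq_of_eq (Quotient.sound h) (ht s s' h),
    fun _ _ hs => relabel_of_eq hs⟩

/-- Labelings with the same restriction j can differ only outside the through-blocks, where
relabeling changes nothing. -/
lemma eq_of_relabel_eq {n : ℕ} {q : Fin n → Quotient p.rel} {i j : p.ThroughBlock → Fin N}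
    {t t' : Fin n → Fin N} (ht : ∀ b s, q s = b.1 → t s = j b) (ht' : ∀ b s, q s = b.1 → t' s = j b)
    (h : relabel q i t = relabel q i t') : t = t' := by
  funext s
  by_cases hb : ∃ b : p.ThroughBlock, q s = b.1
  · obtain ⟨b, hb⟩ := hb
    rw [ht b s hb, ht' b s hb]
  · rw [← relabel_of_ne (i := i) (t := t) hb, h, relabel_of_ne hb]

/-- Relabeling the through-blocks injects T_j into T_i for all i and j. As N ≥ 1, constant labelings
exist, so the common size is not zero. -/
lemma exists_card_T (hN : 1 ≤ N) (p : ColPartition) :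
    ∃ c ≠ 0, ∀ i : p.ThroughBlock → Fin N, (p.T i).card = c := by
  have hle : ∀ i j : p.ThroughBlock → Fin N, (p.T j).card ≤ (p.T i).card := fun i j =>
    Finset.card_le_card_of_injOn _ (fun t ht => relabel_mem_T i ((mem_T j).1 ht).1)
      fun t ht t' ht' h => eq_of_relabel_eq ((mem_T j).1 ht).2 ((mem_T j).1 ht').2 h
  let i₀ : p.ThroughBlock → Fin N := fun _ => ⟨0, hN⟩
  refine ⟨(p.T i₀).card, ?_, fun i => (hle i₀ i).antisymm (hle i i₀)⟩
  exact Finset.card_ne_zero_of_mem (relabel_mem_T i₀ (t := fun _ => ⟨0, hN⟩) fun _ _ _ => rfl)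

lemma exists_card_T' (hN : 1 ≤ N) (p : ColPartition) :
    ∃ c ≠ 0, ∀ i : p.ThroughBlock → Fin N, (p.T' i).card = c := by
  have hle : ∀ i j : p.ThroughBlock → Fin N, (p.T' j).card ≤ (p.T' i).card := fun i j =>
    Finset.card_le_card_of_injOn _ (fun t ht => relabel_mem_T' i ((mem_T' j).1 ht).1)
      fun t ht t' ht' h => eq_of_relabel_eq ((mem_T' j).1 ht).2 ((mem_T' j).1 ht').2 h
  let i₀ : p.ThroughBlock → Fin N := fun _ => ⟨0, hN⟩
  refine ⟨(p.T' i₀).card, ?_, fun i => (hle i₀ i).antisymm (hle i i₀)⟩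
  exact Finset.card_ne_zero_of_mem (relabel_mem_T' i₀ (t := fun _ => ⟨0, hN⟩) fun _ _ _ => rfl)

lemma T_nonempty (hN : 1 ≤ N) (i : p.ThroughBlock → Fin N) : (p.T i).Nonempty :=
  ⟨_, relabel_mem_T i (t := fun _ => ⟨0, hN⟩) fun _ _ _ => rfl⟩

lemma T'_nonempty (hN : 1 ≤ N) (i : p.ThroughBlock → Fin N) : (p.T' i).Nonempty :=
  ⟨_, relabel_mem_T' i (t := fun _ => ⟨0, hN⟩) fun _ _ _ => rfl⟩

end ColPartition

/-! ### Words in the entries of a matrix -/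

section Words

variable {A : Type*} [Ring A] {N n : ℕ}

/-- The matrix of the words `y^ω_{s,t}`. -/
def wordMatrix [Star A] (y : Fin N → Fin N → A) (ω : Fin n → Color) :
    Matrix (Fin n → Fin N) (Fin n → Fin N) A := fun s t => wordProd y ω s t

/-- Transposing y exchanges the indices of each letter but keeps the order of the letters. -/
lemma wordMatrix_transpose [Star A] (y : Fin N → Fin N → A) (ω : Fin n → Color) :
    wordMatrix (fun i j => y j i) ω = (wordMatrix y ω).transpose := rfl

lemma wordProd_succ [Star A] (y : Fin N → Fin N → A) (ω : Fin (n + 1) → Color)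
    (s t : Fin (n + 1) → Fin N) : wordProd y ω s t =
      (ω 0).act (y (s 0) (t 0)) * wordProd y (Fin.tail ω) (Fin.tail s) (Fin.tail t) := by
  simp [wordProd, List.ofFn_succ, Fin.tail]

lemma sum_fin_succ_pi {M : Type*} [AddCommMonoid M] (f : (Fin (n + 1) → Fin N) → M) :
    ∑ t, f t = ∑ a, ∑ t : Fin n → Fin N, f (Fin.cons a t) := by
  rw [← Fintype.sum_prod_type', ← (Fin.consEquiv fun _ => Fin N).sum_comp]
  rfl

lemma fin_succ_eq_iff (s t : Fin (n + 1) → Fin N) :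
    s = t ↔ s 0 = t 0 ∧ Fin.tail s = Fin.tail t := by
  refine ⟨fun h => by simp [h], fun h => ?_⟩
  rw [← Fin.cons_self_tail s, ← Fin.cons_self_tail t, h.1, h.2]

variable [StarRing A]

lemma wordMatrix_one (ω : Fin n → Color) :
    wordMatrix (fun i j : Fin N => if i = j then (1 : A) else 0) ω = 1 := by
  ext s t
  rw [wordMatrix, Matrix.one_apply]
  induction n with
  | zero => simp [wordProd, Subsingleton.elim s t]
  | succ n ih =>
    rw [wordProd_succ, ih]
    simp only [fin_succ_eq_iff s t]
    have : ∀ c : Color, c.act (if s 0 = t 0 then (1 : A) else 0) = if s 0 = t 0 then 1 else 0 := by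
      intro c
      cases c <;> split_ifs <;> simp [Color.act]
    rw [this]
    split_ifs <;> simp_all

lemma commute_wordProd {a : A} {y : Fin N → Fin N → A} (ω : Fin n → Color)
    (h : ∀ (c : Color) i j, Commute a (c.act (y i j))) (s t : Fin n → Fin N) :
    Commute a (wordProd y ω s t) := by
  refine Commute.list_prod_right _ _ fun b hb => ?_
  obtain ⟨i, rfl⟩ := (List.mem_ofFn' _ _).1 hb
  exact h _ _ _

/-- Words in the entries of a product of matrices with commuting entries. -/
lemma wordMatrix_mul {a b : Fin N → Fin N → A}
    (h : ∀ (c c' : Color) i j k l, Commute (c.act (b i j)) (c'.act (a k l))) (ω : Fin n → Color) :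
    wordMatrix (fun i j => ∑ k, a i k * b k j) ω = wordMatrix a ω * wordMatrix b ω := by
  ext s t
  rw [Matrix.mul_apply]
  simp only [wordMatrix]
  induction n with
  | zero => simp [wordProd]
  | succ n ih =>
    have hact : ∀ (c : Color) i j,
        c.act (∑ k, a i k * b k j) = ∑ k, c.act (a i k) * c.act (b k j) := by
      intro c i j
      cases c
      · rfl
      -- The adjoint reverses each product; commutation of the entries restores the order.
      · simp only [Color.act, star_sum, star_mul]
        exact Finset.sum_congr rfl fun k _ => h .black .black k j i k
    rw [wordProd_succ, hact, ih, sum_fin_succ_pi, Finset.sum_mul]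
    refine Finset.sum_congr rfl fun k _ => ?_
    rw [Finset.mul_sum]
    refine Finset.sum_congr rfl fun r _ => ?_
    rw [wordProd_succ, wordProd_succ]
    simp only [Fin.cons_zero, Fin.tail_cons]
    -- The first letter from b has to pass the remaining word in a.
    have := (commute_wordProd (Fin.tail ω) (h (ω 0) · k (t 0)) (Fin.tail s) r).eq
    rw [mul_assoc, mul_assoc, ← mul_assoc (Color.act _ (b _ _)), this, mul_assoc]

open Matrix in
-- In w w* the first letters are outermost: the induction hypothesis collapses the tails, then the
-- sum over the first letter collapses.
lemma wordMatrix_mul_conjTranspose {u : Fin N → Fin N → A}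
    (h : ∀ (c : Color) i j, ∑ k, c.act (u i k) * star (c.act (u j k)) = if i = j then 1 else 0)
    (ω : Fin n → Color) : wordMatrix u ω * (wordMatrix u ω)ᴴ = 1 := by
  ext s s'
  rw [Matrix.mul_apply, Matrix.one_apply]
  simp only [conjTranspose_apply, wordMatrix]
  induction n with
  | zero => simp [wordProd, Subsingleton.elim s s']
  | succ n ih =>
    rw [sum_fin_succ_pi]
    simp only [wordProd_succ, Fin.cons_zero, Fin.tail_cons, star_mul]
    have e : ∀ k, ∑ t : Fin n → Fin N, (ω 0).act (u (s 0) k) *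
        wordProd u (Fin.tail ω) (Fin.tail s) t * (star (wordProd u (Fin.tail ω) (Fin.tail s') t) *
          star ((ω 0).act (u (s' 0) k))) = if Fin.tail s = Fin.tail s' then
            (ω 0).act (u (s 0) k) * star ((ω 0).act (u (s' 0) k)) else 0 := fun k => by
      simp only [mul_assoc]
      rw [← Finset.mul_sum]
      simp only [← mul_assoc]
      rw [← Finset.sum_mul, ih]
      split_ifs <;> simp
    simp only [e]
    simp only [fin_succ_eq_iff s s']
    split_ifs with h1 h2 h2 <;> simp_all

open Matrix in
-- In w* w the first letters meet in the middle, so they are summed first, after exchanging the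
-- sums.
lemma conjTranspose_mul_wordMatrix {u : Fin N → Fin N → A}
    (h : ∀ (c : Color) i j, ∑ k, star (c.act (u k i)) * c.act (u k j) = if i = j then 1 else 0)
    (ω : Fin n → Color) : (wordMatrix u ω)ᴴ * wordMatrix u ω = 1 := by
  ext s s'
  rw [Matrix.mul_apply, Matrix.one_apply]
  simp only [conjTranspose_apply, wordMatrix]
  induction n with
  | zero => simp [wordProd, Subsingleton.elim s s']
  | succ n ih =>
    rw [sum_fin_succ_pi, Finset.sum_comm]
    simp only [wordProd_succ, Fin.cons_zero, Fin.tail_cons, star_mul]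
    have e : ∀ t : Fin n → Fin N, ∑ k, star (wordProd u (Fin.tail ω) t (Fin.tail s)) *
        star ((ω 0).act (u k (s 0))) * ((ω 0).act (u k (s' 0)) *
          wordProd u (Fin.tail ω) t (Fin.tail s')) = if s 0 = s' 0 then
            star (wordProd u (Fin.tail ω) t (Fin.tail s)) *
              wordProd u (Fin.tail ω) t (Fin.tail s') else 0 := fun t => by
      simp only [mul_assoc]
      rw [← Finset.mul_sum]
      simp only [← mul_assoc]
      rw [← Finset.sum_mul, h]
      split_ifs <;> simp
    simp only [e]
    simp only [fin_succ_eq_iff s s']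
    split_ifs with h1 h2 h2 <;> simp_all

end Words

/-! ### The relations in terms of intertwiners -/

section Relations

variable {N : ℕ}

/-- The matrix `u` satisfies the quantum group relations `R^Gr_p`. -/
def SatisfiesGr {A : Type*} [Ring A] [Star A] (p : ColPartition) (u : Fin N → Fin N → A) : Prop :=
  ∀ r, GrRel p u r → r.1 = r.2

/-- The square matrix `x` satisfies the quantum space relations `R^Sp_p`. -/
def SatisfiesSp {A : Type*} [Ring A] [Star A] (p : ColPartition) (x : Fin N → Fin N → A) : Prop :=
  ∀ r, SpRel (le_refl N) p x r → r.1 = r.2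

section Map

variable {F D : Type*} [Ring F] [StarRing F] [Algebra ℂ F] [Ring D] [StarRing D] [Algebra ℂ D]

lemma map_wordProd (φ : F →⋆ₐ[ℂ] D) (y : Fin N → Fin N → F) {n : ℕ} (ω : Fin n → Color)
    (s t : Fin n → Fin N) :
    φ (wordProd y ω s t) = wordProd (fun i j => φ (y i j)) ω s t := by
  rw [wordProd, wordProd, map_list_prod, List.map_ofFn]
  congr 2
  funext a
  simp only [Function.comp_apply]
  cases ω a
  · rfl
  · exact map_star φ _

/-- Passes between relations in the free *-algebra and relations for concrete matrices: one
direction serves the universal generators, the other the universal property. -/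
lemma satisfiesGr_map_iff (φ : F →⋆ₐ[ℂ] D) (p : ColPartition) (u : Fin N → Fin N → F) :
    SatisfiesGr p (fun i j => φ (u i j)) ↔ ∀ r, GrRel p u r → φ r.1 = φ r.2 := by
  refine ⟨fun h r hr => ?_, fun h r hr => ?_⟩
  · cases hr with
    | both i j γ γ' hγ hγ' => simpa only [map_sum, map_wordProd] using h _ (.both i j γ γ' hγ hγ')
    | upper i γ hγ => simpa only [map_sum, map_wordProd, map_zero] using h _ (.upper i γ hγ)
    | lower j γ' hγ' => simpa only [map_sum, map_wordProd, map_zero] using h _ (.lower j γ' hγ')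
  · cases hr with
    | both i j γ γ' hγ hγ' => simpa only [map_sum, map_wordProd] using h _ (.both i j γ γ' hγ hγ')
    | upper i γ hγ => simpa only [map_sum, map_wordProd, map_zero] using h _ (.upper i γ hγ)
    | lower j γ' hγ' => simpa only [map_sum, map_wordProd, map_zero] using h _ (.lower j γ' hγ')

lemma satisfiesSp_map_iff (φ : F →⋆ₐ[ℂ] D) (p : ColPartition) (x : Fin N → Fin N → F) :
    SatisfiesSp p (fun i j => φ (x i j)) ↔
      ∀ r, SpRel (le_refl N) p x r → φ r.1 = φ r.2 := by
  refine ⟨fun h r hr => ?_, fun h r hr => ?_⟩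
  · cases hr with
    | both i j γ γ' hγ hγ' => simpa only [map_sum, map_wordProd] using h _ (.both i j γ γ' hγ hγ')
    | upper i γ hγ => simpa only [map_sum, map_wordProd, map_zero] using h _ (.upper i γ hγ)
    | lower j γ' hγ' => simpa only [map_sum, map_wordProd, map_zero] using h _ (.lower j γ' hγ')
  · cases hr with
    | both i j γ γ' hγ hγ' => simpa only [map_sum, map_wordProd] using h _ (.both i j γ γ' hγ hγ')
    | upper i γ hγ => simpa only [map_sum, map_wordProd, map_zero] using h _ (.upper i γ hγ)
    | lower j γ' hγ' => simpa only [map_sum, map_wordProd, map_zero] using h _ (.lower j γ' hγ')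

lemma SatisfiesGr.map {p : ColPartition} {u : Fin N → Fin N → F} (h : SatisfiesGr p u)
    (φ : F →⋆ₐ[ℂ] D) : SatisfiesGr p (fun i j => φ (u i j)) :=
  (satisfiesGr_map_iff φ p u).2 fun r hr => congrArg φ (h r hr)

lemma SatisfiesSp.map {p : ColPartition} {x : Fin N → Fin N → F} (h : SatisfiesSp p x)
    (φ : F →⋆ₐ[ℂ] D) : SatisfiesSp p (fun i j => φ (x i j)) :=
  (satisfiesSp_map_iff φ p x).2 fun r hr => congrArg φ (h r hr)

end Map

open Matrix

variable {A : Type*} [Ring A] {p : ColPartition}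

open ColPartition in
-- The upper sums do not involve γ' and the lower sums do not involve γ, so their common value
-- depends only on i and j; it is Z_ij. No T_j or T'_i is empty, as N ≥ 1.
lemma satisfiesGr_iff [Star A] (hN : 1 ≤ N) {u : Fin N → Fin N → A} : SatisfiesGr p u ↔
    ∃ Z : Matrix (p.ThroughBlock → Fin N) (p.ThroughBlock → Fin N) A,
      incMatrix A (p.T (N := N)) * wordMatrix u p.upper = Z * incMatrix A (p.T (N := N)) ∧
      wordMatrix u p.lower * (incMatrix A (p.T' (N := N)))ᵀ = (incMatrix A (p.T' (N := N)))ᵀ * Z := by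
  simp only [incMatrix_mul_eq_iff T_unique, mul_transpose_incMatrix_eq_iff T'_unique,
    forall_notMem_T_iff, forall_notMem_T'_iff]
  constructor
  · intro h
    choose γ₀ hγ₀ using T_nonempty (p := p) hN
    choose γ₁ hγ₁ using T'_nonempty (p := p) hN
    refine ⟨fun i j => ∑ t ∈ p.T i, wordProd u p.upper t (γ₀ j),
      ⟨fun i j γ hγ => ?_, fun i γ hγ => h _ (.upper i γ hγ)⟩,
      ⟨fun i j γ' hγ' => (h _ (.both i j (γ₀ j) γ' (hγ₀ j) hγ')).symm,
        fun j γ' hγ' => h _ (.lower j γ' hγ')⟩⟩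
    -- Two upper sums are compared through the same lower sum.
    exact (h _ (.both i j γ (γ₁ i) hγ (hγ₁ i))).trans
      (h _ (.both i j (γ₀ j) (γ₁ i) (hγ₀ j) (hγ₁ i))).symm
  · rintro ⟨Z, ⟨h1, h2⟩, h3, h4⟩ r hr
    cases hr with
    | both i j γ γ' hγ hγ' => exact (h1 i j γ hγ).trans (h3 i j γ' hγ').symm
    | upper i γ hγ => exact h2 i γ hγ
    | lower j γ' hγ' => exact h4 j γ' hγ'

open ColPartition in
-- Here Y_ij is the common value of the sums. Unlike in the group relations, both rows are summed
-- over the row index of the words, so K and K' act from the same side.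
lemma satisfiesSp_iff [Star A] (hN : 1 ≤ N) {x : Fin N → Fin N → A} : SatisfiesSp p x ↔
    ∃ Y : Matrix (p.ThroughBlock → Fin N) (p.ThroughBlock → Fin N) A,
      incMatrix A (p.T (N := N)) * wordMatrix x p.upper = Y * incMatrix A (p.T (N := N)) ∧
      incMatrix A (p.T' (N := N)) * wordMatrix x p.lower = Y * incMatrix A (p.T' (N := N)) := by
  simp only [incMatrix_mul_eq_iff T_unique, incMatrix_mul_eq_iff T'_unique,
    forall_notMem_T_iff, forall_notMem_T'_iff]
  constructor
  · intro h
    choose γ₀ hγ₀ using T_nonempty (p := p) hN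
    choose γ₁ hγ₁ using T'_nonempty (p := p) hN
    refine ⟨fun i j => ∑ t ∈ p.T i, wordProd x p.upper t (γ₀ j),
      ⟨fun i j γ hγ => ?_, fun i γ hγ => h _ (.upper i γ hγ)⟩,
      ⟨fun i j γ' hγ' => (h _ (.both i j (γ₀ j) γ' (hγ₀ j) hγ')).symm,
        fun j γ' hγ' => h _ (.lower j γ' hγ')⟩⟩
    exact (h _ (.both i j γ (γ₁ j) hγ (hγ₁ j))).trans
      (h _ (.both i j (γ₀ j) (γ₁ j) (hγ₀ j) (hγ₁ j))).symm
  · rintro ⟨Z, ⟨h1, h2⟩, h3, h4⟩ r hr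
    cases hr with
    | both i j γ γ' hγ hγ' => exact (h1 i j γ hγ).trans (h3 i j γ' hγ').symm
    | upper i γ hγ => exact h2 i γ hγ
    | lower i γ' hγ' => exact h4 i γ' hγ'

variable [StarRing A]

lemma SatisfiesSp.mul (hN : 1 ≤ N) {a b : Fin N → Fin N → A} (ha : SatisfiesSp p a)
    (hb : SatisfiesSp p b)
    (hc : ∀ (c c' : Color) i j k l, Commute (c.act (b i j)) (c'.act (a k l))) :
    SatisfiesSp p fun i j => ∑ k, a i k * b k j := by
  obtain ⟨Y, h1, h2⟩ := (satisfiesSp_iff hN).1 ha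
  obtain ⟨Z, h3, h4⟩ := (satisfiesSp_iff hN).1 hb
  refine (satisfiesSp_iff hN).2 ⟨Y * Z, ?_, ?_⟩
  · rw [wordMatrix_mul hc, ← Matrix.mul_assoc, h1, Matrix.mul_assoc, h3, Matrix.mul_assoc]
  · rw [wordMatrix_mul hc, ← Matrix.mul_assoc, h2, Matrix.mul_assoc, h4, Matrix.mul_assoc]

lemma SatisfiesGr.mul (hN : 1 ≤ N) {a b : Fin N → Fin N → A} (ha : SatisfiesGr p a)
    (hb : SatisfiesGr p b)
    (hc : ∀ (c c' : Color) i j k l, Commute (c.act (b i j)) (c'.act (a k l))) :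
    SatisfiesGr p fun i j => ∑ k, a i k * b k j := by
  obtain ⟨Y, h1, h2⟩ := (satisfiesGr_iff hN).1 ha
  obtain ⟨Z, h3, h4⟩ := (satisfiesGr_iff hN).1 hb
  refine (satisfiesGr_iff hN).2 ⟨Y * Z, ?_, ?_⟩
  · rw [wordMatrix_mul hc, ← Matrix.mul_assoc, h1, Matrix.mul_assoc, h3, Matrix.mul_assoc]
  · rw [wordMatrix_mul hc, Matrix.mul_assoc, h4, ← Matrix.mul_assoc, h2, Matrix.mul_assoc]

/-- The source of the character x_ij ↦ δ_ij: the words form the identity matrix, and Y = 1 works. -/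
lemma satisfiesSp_one (hN : 1 ≤ N) :
    SatisfiesSp p fun i j : Fin N => if i = j then (1 : A) else 0 := by
  refine (satisfiesSp_iff hN).2 ⟨1, ?_, ?_⟩ <;>
    rw [wordMatrix_one, Matrix.mul_one, Matrix.one_mul]

/-- The entries of `u` and of its conjugate form unitary matrices. -/
structure IsBiunitary (u : Fin N → Fin N → A) : Prop where
  row : ∀ (c : Color) i j, ∑ k, c.act (u i k) * star (c.act (u j k)) = if i = j then 1 else 0
  col : ∀ (c : Color) i j, ∑ k, star (c.act (u k i)) * c.act (u k j) = if i = j then 1 else 0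

variable [Algebra ℂ A]

/-- The relations give one equation for each row of points; unitarity gives the transposed ones with
the same Z. Two of the four are the space relations for u, the other two those for its transpose. -/
lemma SatisfiesGr.exists_intertwiner (hN : 1 ≤ N) {u : Fin N → Fin N → A} (h : SatisfiesGr p u)
    (hu : IsBiunitary u) : ∃ Z : Matrix (p.ThroughBlock → Fin N) (p.ThroughBlock → Fin N) A,
      (incMatrix A (p.T (N := N)) * wordMatrix u p.upper = Z * incMatrix A (p.T (N := N)) ∧
        incMatrix A (p.T' (N := N)) * wordMatrix u p.lower = Z * incMatrix A (p.T' (N := N))) ∧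
      wordMatrix u p.upper * (incMatrix A (p.T (N := N)))ᵀ = (incMatrix A (p.T (N := N)))ᵀ * Z ∧
        wordMatrix u p.lower * (incMatrix A (p.T' (N := N)))ᵀ = (incMatrix A (p.T' (N := N)))ᵀ * Z := by
  obtain ⟨Z, h1, h2⟩ := (satisfiesGr_iff hN).1 h
  obtain ⟨c, hc0, hc⟩ := p.exists_card_T hN
  obtain ⟨c', hc0', hc'⟩ := p.exists_card_T' hN
  have := incMatrix_intertwiner_of_unitary ColPartition.T_unique ColPartition.T'_unique hc hc' hc0
    hc0' (wordMatrix_mul_conjTranspose hu.row _) (conjTranspose_mul_wordMatrix hu.col _) h1 h2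
  exact ⟨Z, ⟨h1, this.2⟩, this.1, h2⟩

lemma SatisfiesGr.satisfiesSp (hN : 1 ≤ N) {u : Fin N → Fin N → A} (h : SatisfiesGr p u)
    (hu : IsBiunitary u) : SatisfiesSp p u := by
  obtain ⟨Z, hZ, -⟩ := h.exists_intertwiner hN hu
  exact (satisfiesSp_iff hN).2 ⟨Z, hZ⟩

lemma SatisfiesGr.satisfiesSp_transpose (hN : 1 ≤ N) {u : Fin N → Fin N → A}
    (h : SatisfiesGr p u) (hu : IsBiunitary u) : SatisfiesSp p fun i j => u j i := by
  obtain ⟨Z, -, h1, h2⟩ := h.exists_intertwiner hN hu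
  refine (satisfiesSp_iff hN).2 ⟨Zᵀ, ?_, ?_⟩
  · rw [wordMatrix_transpose, ← transpose_inj, transpose_incMatrix_mul, transpose_mul_incMatrix]
    exact h1
  · rw [wordMatrix_transpose, ← transpose_inj, transpose_incMatrix_mul, transpose_mul_incMatrix]
    exact h2

/-- A matrix that satisfies the quantum space relations together with its transpose satisfies the
quantum group relations. -/
lemma SatisfiesSp.satisfiesGr (hN : 1 ≤ N) {v : Fin N → Fin N → A} (h : SatisfiesSp p v)
    (h' : SatisfiesSp p fun i j => v j i) : SatisfiesGr p v := by
  obtain ⟨Y, h1, -⟩ := (satisfiesSp_iff hN).1 h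
  obtain ⟨W, h3, h4⟩ := (satisfiesSp_iff hN).1 h'
  rw [wordMatrix_transpose, ← transpose_inj, transpose_incMatrix_mul,
    transpose_mul_incMatrix, transpose_transpose] at h3 h4
  obtain ⟨c, hc0, hc⟩ := p.exists_card_T hN
  -- The upper row alone identifies Y with Wᵀ; the lower equation for vᵀ then becomes the one for
  -- the group relations.
  have e := incMatrix_intertwiner_unique ColPartition.T_unique hc hc0 h1 h3
  exact (satisfiesGr_iff hN).2 ⟨Y, h1, e ▸ h4⟩

end Relations

/-! ### The mixed-coloured pair partitions -/

namespace ColPartition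

lemma upperPair_throughBlock {a b : Color} (x : (upperPair a b).ThroughBlock) : False :=
  Fin.elim0 x.2.2.choose

lemma mem_T'_upperPair {N : ℕ} {a b : Color} (i : (upperPair a b).ThroughBlock → Fin N)
    (t : Fin (upperPair a b).l → Fin N) : t ∈ (upperPair a b).T' i :=
  (mem_T' _).2 ⟨fun s => Fin.elim0 s, fun x => (upperPair_throughBlock x).elim⟩

lemma const_mem_T_upperPair {N : ℕ} {a b : Color} (i : (upperPair a b).ThroughBlock → Fin N)
    (s : Fin N) : (fun _ => s) ∈ (upperPair a b).T i :=
  (mem_T _).2 ⟨fun _ _ _ => rfl, fun x => (upperPair_throughBlock x).elim⟩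

lemma sum_T_upperPair {N : ℕ} {M : Type*} [AddCommMonoid M] {a b : Color}
    (i : (upperPair a b).ThroughBlock → Fin N) (f : (Fin (upperPair a b).k → Fin N) → M) :
    ∑ t ∈ (upperPair a b).T i, f t = ∑ s : Fin N, f (fun _ => s) := by
  symm
  refine Finset.sum_bij (fun s _ => fun _ => s) (fun s _ => const_mem_T_upperPair i s)
    (fun s _ s' _ h => congrFun h (0 : Fin 2)) (fun t ht => ?_) (fun _ _ => rfl)
  refine ⟨t (0 : Fin 2), Finset.mem_univ _, ?_⟩
  funext s
  exact ((mem_T _).1 ht).1 (0 : Fin 2) s trivial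

lemma sum_T'_upperPair {N : ℕ} {M : Type*} [AddCommMonoid M] {a b : Color}
    (i : (upperPair a b).ThroughBlock → Fin N) (f : (Fin (upperPair a b).l → Fin N) → M) :
    ∑ t ∈ (upperPair a b).T' i, f t = f (fun s => Fin.elim0 s) := by
  rw [Finset.sum_eq_single_of_mem _ (mem_T'_upperPair i _)]
  intro t _ ht
  exact (ht (funext fun s => Fin.elim0 s)).elim

end ColPartition

section Pairs

open ColPartition

variable {A : Type*} [Ring A] [StarRing A] {N : ℕ} {u : Fin N → Fin N → A}

/-- The only upper word is the empty one, with value 1, which gives the diagonal; the pairs i ≠ j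
are the non-valid labelings. -/
lemma SatisfiesGr.lowerPair_sum {a b : Color} (h : SatisfiesGr (lowerPair a b) u) (i j : Fin N) :
    ∑ k, a.act (u i k) * b.act (u j k) = if i = j then 1 else 0 := by
  split_ifs with hij
  · subst hij
    have hr := h _ (.both (fun x => (lowerPair_throughBlock x).elim)
      (fun x => (lowerPair_throughBlock x).elim) (fun s => Fin.elim0 s) (fun _ => i)
      (mem_T_lowerPair _ _) (const_mem_T'_lowerPair _ _))
    rw [sum_T'_lowerPair, sum_T_lowerPair] at hr
    simpa [wordProd, lowerPair, List.ofFn_succ] using hr.symm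
  · have hr := h _ (.lower (fun x => (lowerPair_throughBlock x).elim) (![i, j] : Fin 2 → Fin N)
      fun hv => hij (hv (0 : Fin 2) (1 : Fin 2) trivial))
    rw [sum_T'_lowerPair] at hr
    simpa [wordProd, lowerPair, List.ofFn_succ] using hr

lemma SatisfiesGr.upperPair_sum {a b : Color} (h : SatisfiesGr (upperPair a b) u) (i j : Fin N) :
    ∑ k, a.act (u k i) * b.act (u k j) = if i = j then 1 else 0 := by
  split_ifs with hij
  · subst hij
    have hr := h _ (.both (fun x => (upperPair_throughBlock x).elim)
      (fun x => (upperPair_throughBlock x).elim) (fun _ => i) (fun s => Fin.elim0 s)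
      (const_mem_T_upperPair _ _) (mem_T'_upperPair _ _))
    rw [sum_T'_upperPair, sum_T_upperPair] at hr
    simpa [wordProd, upperPair, List.ofFn_succ] using hr
  · have hr := h _ (.upper (fun x => (upperPair_throughBlock x).elim) (![i, j] : Fin 2 → Fin N)
      fun hv => hij (hv (0 : Fin 2) (1 : Fin 2) trivial))
    rw [sum_T_upperPair] at hr
    simpa [wordProd, upperPair, List.ofFn_succ] using hr

lemma isBiunitary_of_satisfiesGr (h : ∀ p ∈ mixedPairs, SatisfiesGr p u) : IsBiunitary u where
  row c i j := by
    cases c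
    · exact (h (lowerPair .white .black) (by simp [mixedPairs])).lowerPair_sum i j
    · simpa [Color.act] using
        (h (lowerPair .black .white) (by simp [mixedPairs])).lowerPair_sum i j
  col c i j := by
    cases c
    -- In the column relations the adjoint stands first, so the colours appear in the opposite
    -- order.
    · exact (h (upperPair .black .white) (by simp [mixedPairs])).upperPair_sum i j
    · simpa [Color.act] using
        (h (upperPair .white .black) (by simp [mixedPairs])).upperPair_sum i j

end Pairs

/-! ### The universal C*-algebras -/

section Universal

variable {N : ℕ} {P : Set ColPartition}

lemma EasyQG.satisfiesGr {p : ColPartition} (hp : p ∈ P) : SatisfiesGr p (EasyQG.u N P) :=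
  (satisfiesGr_map_iff (univSeminorm (easyRelations N P)).toComplHom p _).2 fun _ hr =>
    UnivCStar.toComplHom_eq_of_mem ⟨p, hp, hr⟩

lemma PQS.satisfiesSp {p : ColPartition} (hp : p ∈ P) :
    SatisfiesSp p (PQS.x (le_refl N) P) :=
  (satisfiesSp_map_iff (univSeminorm (pqsRelations (le_refl N) P)).toComplHom p _).2 fun _ hr =>
    UnivCStar.toComplHom_eq_of_mem ⟨p, hp, hr⟩

lemma EasyQG.exists_hom (hP : ColPartition.mixedPairs ⊆ P) {D : Type v} [CStarAlgebra D]
    {v : Fin N → Fin N → D} (hv : ∀ p ∈ P, SatisfiesGr p v) :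
    ∃ φ : EasyQG N P →⋆ₐ[ℂ] D, ∀ i j, φ (EasyQG.u N P i j) = v i j := by
  have key : ∀ r ∈ easyRelations N P, FreeStarAlg.lift (fun g => v g.1 g.2) r.1
      = FreeStarAlg.lift (fun g => v g.1 g.2) r.2 := by
    rintro r ⟨p, hp, hr⟩
    have hL := FreeStarAlg.lift_gen fun g : Fin N × Fin N => v g.1 g.2
    generalize (FreeStarAlg.lift fun g : Fin N × Fin N => v g.1 g.2) = L at hL ⊢
    have h := satisfiesGr_map_iff L p fun i j => FreeStarAlg.gen (i, j)
    simp only [hL] at h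
    exact h.1 (hv p hp) r hr
  obtain ⟨φ, hφ⟩ := UnivCStar.exists_hom (easy_bddAbove N P hP) _ key
  exact ⟨φ, fun i j => hφ (i, j)⟩

lemma PQS.exists_hom (hP : ColPartition.mixedPairs ⊆ P) {D : Type v} [CStarAlgebra D]
    {x : Fin N → Fin N → D} (hx : ∀ p ∈ P, SatisfiesSp p x) :
    ∃ φ : PQS (le_refl N) P →⋆ₐ[ℂ] D, ∀ i j, φ (PQS.x (le_refl N) P i j) = x i j := by
  have key : ∀ r ∈ pqsRelations (le_refl N) P, FreeStarAlg.lift (fun g => x g.1 g.2) r.1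
      = FreeStarAlg.lift (fun g => x g.1 g.2) r.2 := by
    rintro r ⟨p, hp, hr⟩
    have hL := FreeStarAlg.lift_gen fun g : Fin N × Fin N => x g.1 g.2
    generalize (FreeStarAlg.lift fun g : Fin N × Fin N => x g.1 g.2) = L at hL ⊢
    have h := satisfiesSp_map_iff L p fun i j => FreeStarAlg.gen (i, j)
    simp only [hL] at h
    exact h.1 (hx p hp) r hr
  obtain ⟨φ, hφ⟩ := UnivCStar.exists_hom (pqs_bddAbove (le_refl N) P hP) _ key
  exact ⟨φ, fun i j => hφ (i, j)⟩

lemma EasyQG.isBiunitary (hP : ColPartition.mixedPairs ⊆ P) : IsBiunitary (EasyQG.u N P) :=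
  isBiunitary_of_satisfiesGr fun _ hp => EasyQG.satisfiesGr (hP hp)

end Universal

/-! ### The commuting factors of the minimal tensor product. -/

section MinTensorFactors

variable (A : Type u) (B : Type v) [CStarAlgebra A] [CStarAlgebra B]

/-- The embedding `a ↦ a ⊗ 1`. -/
def minTensorLeft : A →⋆ₐ[ℂ] MinTensor A B :=
  (minTensorSeminorm A B).toComplHom.comp
    { (Algebra.TensorProduct.includeLeft : A →ₐ[ℂ] A ⊗[ℂ] B) with
      map_star' := fun a => by
        change star a ⊗ₜ[ℂ] (1 : B) = star (a ⊗ₜ[ℂ] (1 : B))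
        rw [TensorProduct.star_tmul, star_one] }

/-- The embedding `b ↦ 1 ⊗ b`. -/
def minTensorRight : B →⋆ₐ[ℂ] MinTensor A B :=
  (minTensorSeminorm A B).toComplHom.comp
    { (Algebra.TensorProduct.includeRight : B →ₐ[ℂ] A ⊗[ℂ] B) with
      map_star' := fun b => by
        change (1 : A) ⊗ₜ[ℂ] star b = star ((1 : A) ⊗ₜ[ℂ] b)
        rw [TensorProduct.star_tmul, star_one] }

variable {A B}

lemma minTensorLeft_mul_minTensorRight (a : A) (b : B) :
    minTensorLeft A B a * minTensorRight A B b = minTmul a b := by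
  change (minTensorSeminorm A B).toComplHom (a ⊗ₜ[ℂ] 1)
    * (minTensorSeminorm A B).toComplHom (1 ⊗ₜ[ℂ] b) = _
  rw [← map_mul, Algebra.TensorProduct.tmul_mul_tmul, mul_one, one_mul]
  rfl

lemma minTensorRight_mul_minTensorLeft (a : A) (b : B) :
    minTensorRight A B b * minTensorLeft A B a = minTmul a b := by
  change (minTensorSeminorm A B).toComplHom (1 ⊗ₜ[ℂ] b)
    * (minTensorSeminorm A B).toComplHom (a ⊗ₜ[ℂ] 1) = _
  rw [← map_mul, Algebra.TensorProduct.tmul_mul_tmul, mul_one, one_mul]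
  rfl

lemma commute_act_minTensor (c c' : Color) (a : A) (b : B) :
    Commute (c.act (minTensorRight A B b)) (c'.act (minTensorLeft A B a)) := by
  have h : ∀ (a : A) (b : B), Commute (minTensorRight A B b) (minTensorLeft A B a) := fun a b =>
    (minTensorRight_mul_minTensorLeft a b).trans (minTensorLeft_mul_minTensorRight a b).symm
  cases c <;> cases c' <;> simp only [Color.act, ← map_star] <;> exact h _ _

variable {N : ℕ} {p : ColPartition} {a : Fin N → Fin N → A} {b : Fin N → Fin N → B}

/-- The matrix is the product of (a_ij ⊗ 1) and (1 ⊗ b_ij), whose entries commute. -/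
lemma SatisfiesSp.minTmul (hN : 1 ≤ N) (ha : SatisfiesSp p a) (hb : SatisfiesSp p b) :
    SatisfiesSp p fun i j => ∑ k, minTmul (a i k) (b k j) := by
  simp only [← minTensorLeft_mul_minTensorRight]
  exact (ha.map (minTensorLeft A B)).mul hN (hb.map (minTensorRight A B))
    fun c c' _ _ _ _ => commute_act_minTensor c c' _ _

lemma SatisfiesGr.minTmul (hN : 1 ≤ N) (ha : SatisfiesGr p a) (hb : SatisfiesGr p b) :
    SatisfiesGr p fun i j => ∑ k, minTmul (a i k) (b k j) := by
  simp only [← minTensorLeft_mul_minTensorRight]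
  exact (ha.map (minTensorLeft A B)).mul hN (hb.map (minTensorRight A B))
    fun c c' _ _ _ _ => commute_act_minTensor c c' _ _

end MinTensorFactors

/-! ### The quantum symmetry group -/

section SymmetryGroup

variable {N : ℕ} {P : Set ColPartition}

lemma EasyQG.isCMQG (hN : 1 ≤ N) (hP : ColPartition.mixedPairs ⊆ P) :
    IsCMQG (EasyQG.u N P) where
  generates := by
    have e : {a : EasyQG N P | ∃ i j, a = EasyQG.u N P i j}
        = Set.range (UnivCStar.gen (easyRelations N P)) := by
      ext a
      exact ⟨fun ⟨i, j, h⟩ => ⟨(i, j), h.symm⟩, fun ⟨g, h⟩ => ⟨g.1, g.2, h.symm⟩⟩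
    rw [e]
    exact UnivCStar.adjoin_gen_dense _
  isUnit := by
    have h := EasyQG.isBiunitary (N := N) hP
    -- The inverse of u is its adjoint; that of the conjugate matrix will be the transpose of u.
    refine ⟨⟨EasyQG.u N P, (EasyQG.u N P).conjTranspose, ?_, ?_⟩, rfl⟩
    · ext i j
      simpa [Matrix.mul_apply, Matrix.one_apply, Color.act] using h.row .white i j
    · ext i j
      simpa [Matrix.mul_apply, Matrix.one_apply, Color.act] using h.col .white i j
  isUnit_conj := by
    have h := EasyQG.isBiunitary (N := N) hP
    refine ⟨⟨(EasyQG.u N P).map star, (EasyQG.u N P).transpose, ?_, ?_⟩, rfl⟩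
    · ext i j
      simpa [Matrix.mul_apply, Matrix.one_apply, Color.act] using h.row .black i j
    · ext i j
      simpa [Matrix.mul_apply, Matrix.one_apply, Color.act] using h.col .black i j
  comul := EasyQG.exists_hom hP fun _ hp =>
    (EasyQG.satisfiesGr hp).minTmul hN (EasyQG.satisfiesGr hp)

lemma EasyQG.hasLeftAction (hN : 1 ≤ N) (hP : ColPartition.mixedPairs ⊆ P) :
    HasLeftAction (EasyQG.u N P) (PQS.x (le_refl N) P) :=
  PQS.exists_hom hP fun _ hp => ((EasyQG.satisfiesGr hp).satisfiesSp hN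
    (EasyQG.isBiunitary hP)).minTmul hN (PQS.satisfiesSp hp)

lemma EasyQG.hasRightAction (hN : 1 ≤ N) (hP : ColPartition.mixedPairs ⊆ P) :
    HasRightAction (EasyQG.u N P) (PQS.x (le_refl N) P) :=
  PQS.exists_hom hP fun _ hp => ((EasyQG.satisfiesGr hp).satisfiesSp_transpose hN
    (EasyQG.isBiunitary hP)).minTmul hN (PQS.satisfiesSp hp)

/-- Slicing an action with the character `x_{ij} ↦ δ_{ij}` shows that the acting matrix satisfies
the quantum space relations. -/
lemma satisfiesSp_of_action (hN : 1 ≤ N) (hP : ColPartition.mixedPairs ⊆ P) {A : Type u}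
    [CStarAlgebra A] {v : Fin N → Fin N → A}
    (α : PQS (le_refl N) P →⋆ₐ[ℂ] MinTensor A (PQS (le_refl N) P))
    (hα : ∀ i j, α (PQS.x (le_refl N) P i j) = ∑ k, minTmul (v i k) (PQS.x (le_refl N) P k j))
    {p : ColPartition} (hp : p ∈ P) : SatisfiesSp p v := by
  obtain ⟨ε, hε⟩ := PQS.exists_hom (D := ℂ) hP fun p _ => satisfiesSp_one (p := p) hN
  obtain ⟨σ, hσ⟩ := exists_minSlice A ε
  convert (PQS.satisfiesSp hp).map (σ.comp α) with i j
  rw [StarAlgHom.comp_apply, hα, map_sum]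
  simp [hσ, hε]

lemma EasyQG.isQuantumSymmetryGroup (hN : 1 ≤ N) (hP : ColPartition.mixedPairs ⊆ P) :
    IsQuantumSymmetryGroup.{0, 0, w} (EasyQG.u N P) (PQS.x (le_refl N) P) where
  isCMQG := EasyQG.isCMQG hN hP
  left := EasyQG.hasLeftAction hN hP
  right := EasyQG.hasRightAction hN hP
  maximal A' _ v _ hl hr := by
    obtain ⟨α, hα⟩ := hl
    obtain ⟨β, hβ⟩ := hr
    exact EasyQG.exists_hom hP fun p hp => (satisfiesSp_of_action hN hP α hα hp).satisfiesGr hN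
      (satisfiesSp_of_action (v := fun i j => v j i) hN hP β hβ hp)

/-! ### Uniqueness: *-homomorphisms are determined by generators. -/

lemma StarAlgHom.eq_of_adjoin_dense {A : Type u} {B : Type v} [CStarAlgebra A] [CStarAlgebra B]
    {s : Set A} (hs : (StarAlgebra.adjoin ℂ s).topologicalClosure = ⊤) {φ ψ : A →⋆ₐ[ℂ] B}
    (h : ∀ a ∈ s, φ a = ψ a) : φ = ψ := by
  have hle : StarAlgebra.adjoin ℂ s ≤ StarAlgHom.equalizer φ ψ := StarAlgebra.adjoin_le h
  have hφ : Continuous φ := AddMonoidHomClass.continuous_of_bound φ 1 fun a => by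
    simpa using NonUnitalStarAlgHom.norm_apply_le φ a
  have hψ : Continuous ψ := AddMonoidHomClass.continuous_of_bound ψ 1 fun a => by
    simpa using NonUnitalStarAlgHom.norm_apply_le ψ a
  ext a
  have ha : a ∈ (StarAlgebra.adjoin ℂ s).topologicalClosure := hs ▸ trivial
  exact closure_minimal (s := (StarAlgebra.adjoin ℂ s : Set A)) (t := {a | φ a = ψ a}) hle
    (isClosed_eq hφ hψ) ha

/-- Matrices whose entries generate C*-algebras and are mapped to each other by *-homomorphisms
are identified by a *-isomorphism. -/
lemma exists_starAlgEquiv_of_generates {A : Type u} {B : Type v} [CStarAlgebra A] [CStarAlgebra B]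
    {u : Matrix (Fin N) (Fin N) A} {v : Matrix (Fin N) (Fin N) B}
    (hu : (StarAlgebra.adjoin ℂ {a : A | ∃ i j, a = u i j}).topologicalClosure = ⊤)
    (hv : (StarAlgebra.adjoin ℂ {b : B | ∃ i j, b = v i j}).topologicalClosure = ⊤)
    (φ : A →⋆ₐ[ℂ] B) (hφ : ∀ i j, φ (u i j) = v i j) (ψ : B →⋆ₐ[ℂ] A)
    (hψ : ∀ i j, ψ (v i j) = u i j) : ∃ e : A ≃⋆ₐ[ℂ] B, ∀ i j, e (u i j) = v i j := by
  refine ⟨StarAlgEquiv.ofStarAlgHom φ ψ ?_ ?_, hφ⟩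
  · refine StarAlgHom.eq_of_adjoin_dense hu ?_
    rintro _ ⟨i, j, rfl⟩
    simp [hφ, hψ]
  · refine StarAlgHom.eq_of_adjoin_dense hv ?_
    rintro _ ⟨i, j, rfl⟩
    simp [hφ, hψ]

end SymmetryGroup

end

theorem mainTheorem4 (N : ℕ) (hN : 1 ≤ N) (P : Set ColPartition)
    (hP : ColPartition.mixedPairs ⊆ P) :
    IsQuantumSymmetryGroup.{0, 0, w} (EasyQG.u N P) (PQS.x (le_refl N) P) ∧
    ∀ (A : Type w) [CStarAlgebra A] (v : Matrix (Fin N) (Fin N) A),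
      IsQuantumSymmetryGroup.{w, 0, 0} v (PQS.x (le_refl N) P) →
        ∃ e : EasyQG N P ≃⋆ₐ[ℂ] A, ∀ i j, e (EasyQG.u N P i j) = v i j := by
  refine ⟨EasyQG.isQuantumSymmetryGroup hN hP, fun A _ v hv => ?_⟩
  -- Here `EasyQG N P` is maximal among groups in the universe `w` of `A`; the maximality of `A` is
  -- needed in universe 0, where `EasyQG N P` lives.
  have hu := EasyQG.isQuantumSymmetryGroup.{w} hN hP
  obtain ⟨φ, hφ⟩ := hu.maximal A v hv.isCMQG hv.left hv.right
  obtain ⟨ψ, hψ⟩ := hv.maximal _ _ hu.isCMQG hu.left hu.right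
  exact exists_starAlgEquiv_of_generates hu.isCMQG.generates hv.isCMQG.generates φ hφ ψ hψ
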